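/- All graphs are finite; loops and parallel edges are allowed, and a loop contributes $2$ to the degree of its end. A *cycle* is a graph in which every vertex has even degree (it may be disconnected or without edges), and a *circuit* is a connected $2$-regular graph (a loop is a circuit of length $1$, a pair of parallel edges one of length $2$). A subgraph $C$ of $G$ is *non-separating* if $G-E(C)$ is connected. A *$k$-CDC* of $G$ is a family of $k$ cycles of $G$ (subgraphs of $G$; repetitions and edgeless members are allowed) such that every edge of $G$ lies in precisely two members of the family. For $X\subseteq E(G)$, $G/X$ is obtained from $G$ by deleting the edges in $X$ and identifying each component of the spanning subgraph with edge set $X$ to a single vertex; all other edges are kept, possibly as loops or parallel edges. A graph $G'$ is *$(4,H)$-girth-degenerate* if a graph isomorphic to $H$ can be obtained from $G'$ by a (possibly empty) series of contractions of circuits, each of length at most $4$ at the time it is contracted. **Lemma.** Let $G$ be a graph and let $C$ be a non-separating cycle of $G$. Suppose that $G/E(C)$ is $(4,H)$-girth-degenerate, where $H$ is a graph of maximum degree $\Delta(H)\le 3$ that has a $k$-CDC. Then: 1. if $k\ge 5$, then $G$ has a $(k+1)$-CDC of which $C$ is a member; 2. if $k\le 4$, then $G$ has a $5$-CDC of which $C$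 is a member. -/

import Mathlib

namespace Graph

/-- The degree of `v` in the (finite) multigraph `G`; a loop at `v` counts twice. -/
noncomputable def deg {α β : Type*} (G : Graph α β) (v : α) : ℕ :=
  {e | G.IsNonloopAt e v}.ncard + 2 * {e | G.IsLoopAt e v}.ncard

/-- A graph is connected if it has a vertex and any two vertices are joined by a walk. -/
def IsConnected {α β : Type*} (G : Graph α β) : Prop :=
  V(G).Nonempty ∧ ∀ x ∈ V(G), ∀ y ∈ V(G), Relation.ReflTransGen G.Adj x y

/-- A cycle is a graph all of whose degrees are even (not necessarily connected, possibly without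
edges). -/
def IsEvenCycle {α β : Type*} (C : Graph α β) : Prop :=
  ∀ v ∈ V(C), Even (C.deg v)

/-- A circuit is a connected 2-regular graph. A loop is a circuit with one edge, and two parallel
edges form a circuit with two edges. -/
def IsCircuit {α β : Type*} (K : Graph α β) : Prop :=
  K.IsConnected ∧ ∀ v ∈ V(K), K.deg v = 2

/-- The subgraph `C` of `G` is non-separating if `G - E(C)` (all vertices are kept) is connected.
In particular `G` itself is connected. -/
def IsNonseparating {α β : Type*} (G C : Graph α β) : Prop :=
  C ≤ G ∧ (G.deleteEdges E(C)).IsConnected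

/-- Two vertices are equivalent if they are joined by a walk of `G` with all edges in `X`. -/
def contractSetoid {α β : Type*} (G : Graph α β) (X : Set β) : Setoid α :=
  Relation.EqvGen.setoid (G.restrict X).Adj

/-- A chosen vertex in the class of `x`. -/
noncomputable def contractRep {α β : Type*} (G : Graph α β) (X : Set β) (x : α) : α :=
  (Quotient.mk (G.contractSetoid X) x).out

theorem contractRep_eq_iff {α β : Type*} (G : Graph α β) (X : Set β) (x y : α) :
    G.contractRep X x = G.contractRep X y ↔ Relation.EqvGen (G.restrict X).Adj x y := by
  unfold contractRep
  rw [Quotient.out_inj]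
  exact Quotient.eq (r := G.contractSetoid X)

theorem contractRep_mem {α β : Type*} (G : Graph α β) (X : Set β) {x : α} (hx : x ∈ V(G)) :
    G.contractRep X x ∈ V(G) := by
  have h : Relation.EqvGen (G.restrict X).Adj (G.contractRep X x) x :=
    Quotient.mk_out (s := G.contractSetoid X) x
  have key : ∀ a b, Relation.EqvGen (G.restrict X).Adj a b → (a ∈ V(G) ↔ b ∈ V(G)) := by
    intro a b hab
    induction hab with
    | rel a b h =>
      obtain ⟨e, he⟩ := h
      exact ⟨fun _ => he.2.right_mem, fun _ => he.2.left_mem⟩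
    | refl a => exact Iff.rfl
    | symm a b _ ih => exact ih.symm
    | trans a b c _ _ ih₁ ih₂ => exact ih₁.trans ih₂
  exact (key _ _ h).2 hx

/-- The contraction `G / X`: the edges in `X` are removed, and every connected component of the
spanning subgraph with edge set `X` is identified to one vertex (represented by one of its
vertices). All other edges are kept, possibly as loops or parallel edges. -/
noncomputable def contract {α β : Type*} (G : Graph α β) (X : Set β) : Graph α β :=
  (G.deleteEdges X).map (G.contractRep X)

/-- `G₂` arises from `G₁` by contracting one circuit of `G₁` of length at most `k`. -/
def ContractsCircuit {α β : Type*} (k : ℕ) (G₁ G₂ : Graph α β) : Prop :=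
  ∃ K : Graph α β, K ≤ G₁ ∧ K.IsCircuit ∧ E(K).ncard ≤ k ∧ G₂ = G₁.contract E(K)

/-- An isomorphism of multigraphs. -/
structure Isom {α β γ δ : Type*} (G : Graph α β) (H : Graph γ δ) where
  onVertices : V(G) ≃ V(H)
  onEdges : E(G) ≃ E(H)
  isLink_iff : ∀ (e : E(G)) (x y : V(G)),
    G.IsLink e x y ↔ H.IsLink (onEdges e) (onVertices x) (onVertices y)

/-- `G` is `(k, H)`-girth-degenerate: up to isomorphism, `H` is obtained from `G` by successively
contracting (zero or more) circuits of length at most `k`. -/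
def IsGirthDegenerate {α β γ δ : Type*} (k : ℕ) (H : Graph γ δ) (G : Graph α β) : Prop :=
  ∃ G' : Graph α β, Relation.ReflTransGen (ContractsCircuit k) G G' ∧ Nonempty (G'.Isom H)

/-- `S` is a `k`-CDC of `G`: a family of `k` cycles of `G` (repetitions and edgeless members are
allowed) such that every edge of `G` lies in precisely two members. -/
def IsCDC {α β : Type*} {k : ℕ} (G : Graph α β) (S : Fin k → Graph α β) : Prop :=
  (∀ i, S i ≤ G ∧ (S i).IsEvenCycle) ∧ ∀ e ∈ E(G), {i | e ∈ E(S i)}.ncard = 2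

end Graph

/-! Work with mod 2 weightings of the edges of `G`. Let `X` be the set of all edges contracted on
the way from `G` to `G' ≅ H`, including those of `C`. It suffices to find cycles that cover `C` once
and all other edges twice, since adding `C` itself then gives the required CDC.

Four such cycles arise from a `ZMod 2 × ZMod 2`-flow that is nonzero off `C` (`exists_four_cycles`).
Connectedness of `G - E(C)` enters here: it permits a correction supported off `C`. Such flows can
be lifted from `G'` to `G/E(C)`, because undoing the contraction of a circuit of length at most 4
preserves their existence (`exists_flow_of_contract_circuit`). The free shift of the flow along the
circuit fails only if the circuit has four edges carrying all four values, and then a Kempe-type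
switch creates a repetition.

If `k ≤ 4`, the CDC of `G'` itself encodes a nowhere-zero flow, and lifting it is enough. If `k ≥
5`, lift one vertex `a` of `G'` at a time: with everything outside the fibre of `a` merged into one
vertex, a flow exists because `a` has degree at most 3 and is not incident with exactly one non-loop
edge. The four cycles obtained cover the edges at `a` twice. At so small a degree a double cover has
only one pattern up to renaming the cycles, so an injection of `Fin 4` into `Fin k` makes them agree
there with the given `k`-CDC. The local solutions then glue along the edges of `G'`. -/

namespace EdgeSpace

open scoped Classical in
/-- The mod 2 incidence number of the edge `e` and the vertex `x`. -/
noncomputable def inc {V E : Type*} (s t : E → V) (x : V) (e : E) : ZMod 2 :=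
  (if s e = x then 1 else 0) + (if t e = x then 1 else 0)

/-- The mod 2 boundary of an edge weighting. -/
noncomputable def bd {V E M : Type*} [Fintype E] [AddCommGroup M] [Module (ZMod 2) M]
    (s t : E → V) (f : E → M) (x : V) : M :=
  ∑ e, inc s t x e • f e

open scoped Classical in
/-- `x` and `y` are the ends of a (possibly trivial) `x`-`y`-join contained in `X`. -/
def Joined {V E : Type*} [Fintype E] (s t : E → V) (X : Set E) (x y : V) : Prop :=
  ∃ P : E → ZMod 2, (∀ e ∉ X, P e = 0) ∧
    ∀ z, bd s t P z = (if x = z then 1 else 0) + (if y = z then 1 else 0)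

theorem add_self {M : Type*} [AddCommGroup M] [Module (ZMod 2) M] (m : M) : m + m = 0 := by
  have h : ((1 : ZMod 2) + 1) • m = 0 := by
    rw [show (1 : ZMod 2) + 1 = 0 by decide, zero_smul]
  rwa [add_smul, one_smul] at h

theorem zmod_two_eq_zero_or_one (a : ZMod 2) : a = 0 ∨ a = 1 := by
  revert a; decide

/-! ### Mod 2 boundaries, joins and components -/

section Basic

variable {V E M : Type*} [Fintype E] [AddCommGroup M] [Module (ZMod 2) M] (s t : E → V)

theorem bd_add (f g : E → M) (x : V) :
    bd s t (fun e => f e + g e) x = bd s t f x + bd s t g x := by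
  simp only [bd, smul_add, Finset.sum_add_distrib]

theorem bd_zero (x : V) : bd s t (fun _ => (0 : M)) x = 0 := by
  simp [bd]

theorem bd_sum {ι : Type*} (T : Finset ι) (f : ι → E → M) (x : V) :
    bd s t (fun e => ∑ i ∈ T, f i e) x = ∑ i ∈ T, bd s t (f i) x := by
  simp only [bd, Finset.smul_sum]
  exact Finset.sum_comm

theorem bd_smul_const (P : E → ZMod 2) (m : M) (x : V) :
    bd s t (fun e => P e • m) x = bd s t P x • m := by
  simp only [bd, Finset.sum_smul, smul_assoc]

theorem bd_linear {N : Type*} [AddCommGroup N] [Module (ZMod 2) N] (φ : M →ₗ[ZMod 2] N)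
    (f : E → M) (x : V) : bd s t (fun e => φ (f e)) x = φ (bd s t f x) := by
  simp only [bd, map_sum, map_smul]

/-- Summation by parts: boundary and coboundary are adjoint. With `χ` the indicator of a vertex set
this is the cut identity behind every parity argument below. -/
theorem sum_smul_bd_of_mem (T : Finset V) (hT : ∀ e, s e ∈ T ∧ t e ∈ T) (χ : V → ZMod 2)
    (f : E → M) : ∑ x ∈ T, χ x • bd s t f x = ∑ e, (χ (s e) + χ (t e)) • f e := by
  classical
  simp only [bd, Finset.smul_sum, smul_smul]
  rw [Finset.sum_comm]
  refine Finset.sum_congr rfl fun e _ => ?_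
  rw [← Finset.sum_smul]
  congr 1
  simp [inc, mul_add, Finset.sum_add_distrib, hT e]

theorem sum_smul_bd [Fintype V] (χ : V → ZMod 2) (f : E → M) :
    ∑ x, χ x • bd s t f x = ∑ e, (χ (s e) + χ (t e)) • f e :=
  sum_smul_bd_of_mem s t _ (by simp) χ f

variable {s t} {X Y : Set E} {x y z : V}

theorem Joined.refl (X : Set E) (x : V) : Joined s t X x x :=
  ⟨fun _ => 0, fun _ _ => rfl, fun z => by rw [bd_zero, add_self]⟩

theorem Joined.symm (h : Joined s t X x y) : Joined s t X y x := by
  obtain ⟨P, hP, h⟩ := h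
  exact ⟨P, hP, fun z => by rw [h, add_comm]⟩

theorem Joined.trans (h : Joined s t X x y) (h' : Joined s t X y z) : Joined s t X x z := by
  classical
  obtain ⟨P, hP, h⟩ := h
  obtain ⟨Q, hQ, h'⟩ := h'
  refine ⟨fun e => P e + Q e, fun e he => by simp [hP e he, hQ e he], fun w => ?_⟩
  rw [bd_add, h, h']
  have := add_self (if y = w then (1 : ZMod 2) else 0)
  linear_combination this

theorem Joined.mono (hXY : X ⊆ Y) (h : Joined s t X x y) : Joined s t Y x y := by
  obtain ⟨P, hP, h⟩ := h
  exact ⟨P, fun e he => hP e fun h => he (hXY h), h⟩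

theorem Joined.of_mem {e : E} (he : e ∈ X) : Joined s t X (s e) (t e) := by
  classical
  refine ⟨fun e' => if e' = e then 1 else 0, fun e' h => if_neg (by rintro rfl; exact h he),
    fun z => ?_⟩
  simp [bd, inc]

/-- Pair the join with `χ`: edges of `X` contribute nothing, and only the two ends survive. -/
theorem Joined.eq_of_invariant [Fintype V] (h : Joined s t X x y) (χ : V → ZMod 2)
    (hχ : ∀ e ∈ X, χ (s e) = χ (t e)) : χ x = χ y := by
  classical
  obtain ⟨P, hP, h⟩ := h
  have key := sum_smul_bd s t χ P
  have h0 : ∑ e, (χ (s e) + χ (t e)) • P e = 0 := by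
    refine Finset.sum_eq_zero fun e _ => ?_
    by_cases he : e ∈ X
    · rw [hχ e he, add_self, zero_smul]
    · rw [hP e he, smul_zero]
  rw [h0] at key
  simp [h, mul_add, Finset.sum_add_distrib] at key
  have h2 := add_self (χ y)
  linear_combination key - h2

open scoped Classical in
/-- The indicator of the `X`-component of `x`. -/
noncomputable def comp (s t : E → V) (X : Set E) (x : V) : V → ZMod 2 :=
  fun y => if Joined s t X x y then 1 else 0

theorem comp_invariant {e : E} (he : e ∈ X) : comp s t X x (s e) = comp s t X x (t e) := by
  have h : Joined s t X (s e) (t e) := .of_mem he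
  unfold comp
  congr 1
  exact propext ⟨fun h' => h'.trans h, fun h' => h'.trans h.symm⟩

theorem joined_empty_iff [Fintype V] : Joined s t ∅ x y ↔ x = y := by
  classical
  refine ⟨fun h => ?_, fun h => h ▸ .refl _ _⟩
  have := h.eq_of_invariant (fun z => if x = z then 1 else 0) (by simp)
  simpa using this

/-- A vertex weighting is a boundary of a weighting supported on `X` if its sum over every
`X`-component vanishes. -/
theorem exists_bd_eq [Fintype V] (X : Set E) (b : V → M)
    (hb : ∀ χ : V → ZMod 2, (∀ e ∈ X, χ (s e) = χ (t e)) → ∑ x, χ x • b x = 0) :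
    ∃ h : E → M, (∀ e ∉ X, h e = 0) ∧ ∀ x, bd s t h x = b x := by
  classical
  let S : Setoid V := ⟨Joined s t X, fun x => .refl _ x, .symm, .trans⟩
  let r : V → V := fun x => (Quotient.mk S x).out
  have hr : ∀ x, Joined s t X x (r x) := fun x => (Quotient.mk_out (s := S) x).symm
  choose P hP hPb using hr
  -- Transport each `b x` along a join to the representative of its component; the amount collected
  -- there is the component sum, which vanishes.
  refine ⟨fun e => ∑ x, P x e • b x, fun e he => ?_, fun z => ?_⟩
  · exact Finset.sum_eq_zero fun x _ => by rw [hP x e he, zero_smul]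
  · rw [bd_sum]
    simp only [bd_smul_const, hPb, add_smul, Finset.sum_add_distrib]
    have h0 := hb (fun x => if r x = z then 1 else 0) fun e he => by
      have : r (s e) = r (t e) := by
        simp only [r]
        rw [Quotient.sound (s := S) (Joined.of_mem he)]
      rw [this]
    rw [h0]
    simp

end Basic
-- Lifting a flow through a contracted circuit
section Contract

variable {V E : Type*} [Fintype E] {s t : E → V} {X : Set E}

theorem comp_of_joined {x y : V} (h : Joined s t X x y) : comp s t X x y = 1 := if_pos h

theorem comp_of_not_joined {x y : V} (h : ¬ Joined s t X x y) : comp s t X x y = 0 := if_neg h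

theorem joined_of_comp_eq_one {x y : V} (h : comp s t X x y = 1) : Joined s t X x y := by
  by_contra h'
  rw [comp_of_not_joined h'] at h
  exact absurd h (by decide)

/-- Adding `m` along `κ` spoils only those edges of `K` with value `m`, so any `m` missed by `g` on
`K` works. Such an `m` exists as soon as `g` takes fewer than four values there. -/
theorem exists_flow_of_shift {K : Finset E} {κ : E → ZMod 2}
    (hκ : ∀ x, bd s t κ x = 0) (hκK : ∀ e ∈ K, κ e = 1) (hκX : ∀ e ∉ X, e ∉ K → κ e = 0)
    {g : E → ZMod 2 × ZMod 2} (hg : ∀ x, bd s t g x = 0) (hgX : ∀ e ∉ X, e ∉ K → g e ≠ 0)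
    (hcard : ¬ Set.InjOn g K ∨ K.card < 4) (hK4 : K.card ≤ 4) :
    ∃ g' : E → ZMod 2 × ZMod 2, (∀ x, bd s t g' x = 0) ∧ ∀ e ∉ X, g' e ≠ 0 := by
  classical
  have hlt : (K.image g).card < 4 := by
    rcases hcard with h | h
    · refine lt_of_lt_of_le (lt_of_le_of_ne Finset.card_image_le fun h' => h ?_) hK4
      exact Finset.card_image_iff.1 h'
    · exact lt_of_le_of_lt Finset.card_image_le h
  obtain ⟨m, hm⟩ : ∃ m : ZMod 2 × ZMod 2, m ∉ K.image g := by
    by_contra! h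
    rw [Finset.eq_univ_iff_forall.2 h] at hlt
    exact absurd hlt (by decide)
  refine ⟨fun e => g e + κ e • m, fun x => ?_, fun e he => ?_⟩
  · rw [bd_add, bd_smul_const, hg, hκ, zero_smul, add_zero]
  · dsimp only
    by_cases heK : e ∈ K
    · rw [hκK e heK, one_smul]
      intro h
      refine hm (Finset.mem_image.2 ⟨e, heK, ?_⟩)
      have := add_self m
      calc g e = g e + (m + m) := by rw [this, add_zero]
        _ = m := by rw [← add_assoc, h, zero_add]
    · rw [hκX e he heK, zero_smul, add_zero]
      exact hgX e he heK

/-- The linear form on `ZMod 2 × ZMod 2` with kernel `{0, c}`, for `c ≠ 0`. -/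
def killing (c : ZMod 2 × ZMod 2) : ZMod 2 × ZMod 2 →ₗ[ZMod 2] ZMod 2 :=
  c.1 • LinearMap.snd (ZMod 2) (ZMod 2) (ZMod 2) + c.2 • LinearMap.fst (ZMod 2) (ZMod 2) (ZMod 2)

theorem killing_apply (c m : ZMod 2 × ZMod 2) : killing c m = c.1 * m.2 + c.2 * m.1 := rfl

theorem eq_of_killing_eq_zero {c m : ZMod 2 × ZMod 2} (hc : c ≠ 0) (h : killing c m = 0) :
    m = 0 ∨ m = c := by
  rw [killing_apply] at h
  revert c m; decide

theorem killing_self (c : ZMod 2 × ZMod 2) : killing c c = 0 := by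
  rw [killing_apply]
  revert c; decide

theorem sum_eq_of_eq_zero {M : Type*} [AddCommMonoid M] [DecidableEq E] {e f p q : E}
    (hef : e ≠ f) (hep : e ≠ p) (heq : e ≠ q) (hfp : f ≠ p) (hfq : f ≠ q) (hpq : p ≠ q)
    (F : E → M) (hF : ∀ k, k ≠ e → k ≠ f → k ≠ p → k ≠ q → F k = 0) :
    ∑ k, F k = F e + (F f + (F p + F q)) := by
  rw [← Finset.sum_subset (Finset.subset_univ {e, f, p, q})]
  · rw [Finset.sum_insert (by simp [*]), Finset.sum_insert (by simp [*]),
      Finset.sum_pair hpq]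
  · intro k _ hk
    simp only [Finset.mem_insert, Finset.mem_singleton, not_or] at hk
    exact hF k hk.1 hk.2.1 hk.2.2.1 hk.2.2.2

/-- A nowhere-zero `ZMod 2 × ZMod 2`-flow of the contraction of `X ∪ K` gives one of the
contraction of `X`, if `K` is a circuit of length at most four of the latter. -/
theorem exists_flow_of_contract_circuit [Fintype V] {K : Finset E} (hKX : ∀ e ∈ K, e ∉ X) (hK4 : K.card ≤ 4)
    {κ : E → ZMod 2} (hκ : ∀ x, bd s t κ x = 0) (hκK : ∀ e ∈ K, κ e = 1)
    (hκX : ∀ e ∉ X, e ∉ K → κ e = 0)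
    (hconn : ∀ e ∈ K, ∀ e' ∈ K, Joined s t (X ∪ K) (s e) (s e'))
    (hfour : K.card = 4 → ∃ e ∈ K, ∃ f ∈ K,
      ¬ Joined s t X (s e) (t e) ∧ ¬ Joined s t X (s e) (s f) ∧ ¬ Joined s t X (s e) (t f) ∧
      ¬ Joined s t X (t e) (s f) ∧ ¬ Joined s t X (t e) (t f) ∧ ¬ Joined s t X (s f) (t f))
    {g : E → ZMod 2 × ZMod 2} (hg : ∀ x, bd s t g x = 0) (hgX : ∀ e ∉ X, e ∉ K → g e ≠ 0) :
    ∃ g' : E → ZMod 2 × ZMod 2, (∀ x, bd s t g' x = 0) ∧ ∀ e ∉ X, g' e ≠ 0 := by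
  classical
  by_cases hlt : K.card < 4
  · exact exists_flow_of_shift hκ hκK hκX hg hgX (.inr hlt) hK4
  by_cases hinj : Set.InjOn g K
  swap
  · exact exists_flow_of_shift hκ hκK hκX hg hgX (.inl hinj) hK4
  have hK : K.card = 4 := by omega
  obtain ⟨e, heK, f, hfK, n1, n2, n3, n4, n5, n6⟩ := hfour hK
  have hef : e ≠ f := by
    rintro rfl
    exact n2 (.refl _ _)
  have h2 : ((K.erase e).erase f).card = 2 := by
    rw [Finset.card_erase_of_mem (Finset.mem_erase.2 ⟨hef.symm, hfK⟩),
      Finset.card_erase_of_mem heK, hK]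
  obtain ⟨p, q, hpq, hK'⟩ := Finset.card_eq_two.1 h2
  have hp : p ∈ (K.erase e).erase f := by simp [hK']
  have hq : q ∈ (K.erase e).erase f := by simp [hK']
  have hmem : ∀ k, k ∈ K → k ≠ e → k ≠ f → k ≠ p → k = q := by
    intro k hk hke hkf hkp
    have h := Finset.mem_erase.2 ⟨hkf, Finset.mem_erase.2 ⟨hke, hk⟩⟩
    rw [hK', Finset.mem_insert, Finset.mem_singleton] at h
    exact h.resolve_left hkp
  simp only [Finset.mem_erase] at hp hq
  obtain ⟨hfp, hep, hpK⟩ := hp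
  obtain ⟨hfq, heq, hqK⟩ := hq
  have expand {N : Type} [AddCommMonoid N] (F : E → N) (hF : ∀ k ∉ K, F k = 0) :
      ∑ k, F k = F e + (F f + (F p + F q)) :=
    sum_eq_of_eq_zero hef hep.symm heq.symm hfp.symm hfq.symm hpq F fun k h1 h2 h3 h4 =>
      hF k fun hk => h4 (hmem k hk h1 h2 h3)
  have gef : g e ≠ g f := fun h => hef (hinj heK hfK h)
  have gep : g e ≠ g p := fun h => hep (hinj heK hpK h).symm
  have geq : g e ≠ g q := fun h => heq (hinj heK hqK h).symm
  have gfp : g f ≠ g p := fun h => hfp (hinj hfK hpK h).symm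
  have gfq : g f ≠ g q := fun h => hfq (hinj hfK hqK h).symm
  have gpq : g p ≠ g q := fun h => hpq (hinj hpK hqK h)
  -- The four values are all of `ZMod 2 × ZMod 2`, whose sum is zero, so the pairs `e, f` and `p, q`
  -- have the same sum `c`.
  obtain ⟨c, hc⟩ : ∃ c, c = g e + g f := ⟨_, rfl⟩
  have hc' : c = g p + g q := by
    rw [hc]
    generalize g e = a at *
    generalize g f = b at *
    generalize g p = a' at *
    generalize g q = b' at *
    clear hc hK' expand hinj
    revert a b a' b'; decide
  have hc0 : c ≠ 0 := by
    rw [hc]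
    generalize g e = a at *
    generalize g f = b at *
    revert gef
    clear * -
    revert a b; decide
  -- The Kempe subgraph: edges with value outside `{0, c}`, which stay nonzero when `c` is added.
  let Y : Set E := {k | k ∉ X ∧ k ∉ K ∧ killing c (g k) = 1}
  -- Otherwise the Kempe component of `s e` meets `K` only in one vertex of the contraction of `X`.
  -- Pairing with `κ` shows that `e` and exactly one of `p, q` leave it; pairing with `killing c ∘
  -- g` then gives a contradiction, as no other edges contribute to the cut.
  obtain ⟨y, ⟨k, hkK, hky⟩, hyY, hyX⟩ : ∃ y, (∃ k ∈ K, y = s k ∨ y = t k) ∧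
      Joined s t (Y ∪ X) (s e) y ∧ ¬ Joined s t X (s e) y := by
    by_contra! hcon
    have hco : ∀ k ∈ K, ∀ y, (y = s k ∨ y = t k) →
        comp s t (Y ∪ X) (s e) y = comp s t X (s e) y := by
      intro k hk y hy
      by_cases h : Joined s t (Y ∪ X) (s e) y
      · rw [comp_of_joined h, comp_of_joined (hcon y ⟨k, hk, hy⟩ h)]
      · rw [comp_of_not_joined h, comp_of_not_joined fun h' => h (h'.mono Set.subset_union_right)]
    have sum1 := sum_smul_bd s t (comp s t (Y ∪ X) (s e)) (fun k => killing c (g k))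
    simp only [bd_linear, hg, map_zero, smul_zero, Finset.sum_const_zero] at sum1
    rw [expand] at sum1
    swap
    · intro k hk
      by_cases hkY : k ∈ Y ∪ X
      · rw [comp_invariant hkY, add_self, zero_smul]
      · have : killing c (g k) = 0 := by
          rcases zmod_two_eq_zero_or_one (killing c (g k)) with h | h
          · exact h
          · exact absurd ⟨fun h' => hkY (.inr h'), hk, h⟩ fun h' => hkY (.inl h')
        rw [this, smul_zero]
    have sum2 := sum_smul_bd s t (comp s t X (s e)) κ
    simp only [hκ, smul_zero, Finset.sum_const_zero] at sum2
    rw [expand] at sum2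
    swap
    · intro k hk
      by_cases hkX : k ∈ X
      · rw [comp_invariant hkX, add_self, zero_smul]
      · rw [hκX k hkX hk, smul_zero]
    rw [hco e heK _ (.inl rfl), hco e heK _ (.inr rfl), hco f hfK _ (.inl rfl),
      hco f hfK _ (.inr rfl), hco p hpK _ (.inl rfl), hco p hpK _ (.inr rfl),
      hco q hqK _ (.inl rfl), hco q hqK _ (.inr rfl)] at sum1
    rw [hκK e heK, hκK f hfK, hκK p hpK, hκK q hqK] at sum2
    rw [comp_of_joined (.refl X (s e)), comp_of_not_joined n1, comp_of_not_joined n2,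
      comp_of_not_joined n3] at sum1 sum2
    -- Equality would put `g e + r` in `{0, c}`, that is, make `r` equal to `g e` or `g f`.
    have bad : ∀ r, (r = g p ∨ r = g q) → killing c (g e) + killing c r ≠ 0 := by
      intro r hr h
      rw [← map_add] at h
      have hre : g e ≠ r := by rcases hr with rfl | rfl <;> assumption
      have hrf : g f ≠ r := by rcases hr with rfl | rfl <;> assumption
      have := eq_of_killing_eq_zero hc0 h
      rw [hc] at this
      clear * - this hre hrf
      generalize g e = a at *
      generalize g f = b at *
      revert a b r; decide
    generalize comp s t X (s e) (s p) + comp s t X (s e) (t p) = a at *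
    generalize comp s t X (s e) (s q) + comp s t X (s e) (t q) = b at *
    simp only [smul_eq_mul, add_zero, one_mul, zero_mul, zero_add, mul_one] at sum1 sum2
    rcases zmod_two_eq_zero_or_one a with rfl | rfl <;>
      rcases zmod_two_eq_zero_or_one b with rfl | rfl
    · exact absurd sum2 (by decide)
    · refine bad _ (.inr rfl) ?_
      simpa using sum1.symm
    · refine bad _ (.inl rfl) ?_
      simpa using sum1.symm
    · exact absurd sum2 (by decide)
  obtain ⟨S, hSY, hS⟩ := hyY
  have hP : Joined s t (X ∪ K) (s e) y := by
    rcases hky with rfl | rfl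
    · exact hconn e heK k hkK
    · exact (hconn e heK k hkK).trans (.of_mem (.inr hkK))
  obtain ⟨P, hPK, hP⟩ := hP
  have hSK : ∀ k ∈ K, S k = 0 := fun k hk => hSY k (by
    rintro (h | h)
    · exact h.2.1 hk
    · exact hKX k hk h)
  -- Switch by `c` along the Kempe join `S`, closed up by the join `P` through `X ∪ K`.
  have hflow : ∀ x, bd s t (fun k => g k + (S k + P k) • c) x = 0 := by
    intro x
    rw [bd_add, bd_smul_const, bd_add, hS, hP, hg, add_self, zero_smul, zero_add]
  have hnz : ∀ k ∉ X, k ∉ K → g k + (S k + P k) • c ≠ 0 := by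
    intro k hkX hkK
    rw [hPK k (by rintro (h | h); exacts [hkX h, hkK h]), add_zero]
    rcases zmod_two_eq_zero_or_one (S k) with h | h
    · rw [h, zero_smul, add_zero]
      exact hgX k hkX hkK
    · have hkY : k ∈ Y ∪ X := by
        by_contra h'
        rw [hSY k h'] at h
        exact absurd h (by decide)
      have h1 : killing c (g k) = 1 := by
        rcases hkY with h' | h'
        · exact h'.2.2
        · exact absurd h' hkX
      intro h0
      have := congrArg (killing c) h0
      rw [h, one_smul, map_add, h1, killing_self, map_zero] at this
      exact absurd this (by decide)
  refine exists_flow_of_shift hκ hκK hκX hflow hnz (.inl fun hinj' => ?_) hK4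
  -- Adding `c` to just one of two values differing by `c` makes them equal, against injectivity of
  -- the new flow on `K`.
  have collide : ∀ a b : E, a ∈ K → b ∈ K → a ≠ b → c = g a + g b → P a = P b := by
    intro a b ha hb hab hcab
    by_contra hPab
    refine hab (hinj' ha hb ?_)
    simp only [hSK a ha, hSK b hb, zero_add, hcab]
    clear * - hPab
    generalize g a = m at *
    generalize g b = n at *
    generalize P a = i at *
    generalize P b = j at *
    revert m n i j; decide
  have hPef := collide e f heK hfK hef hc
  have hPpq := collide p q hpK hqK hpq hc'
  -- The weighting `P + P p • κ` has the boundary of `P` but on `K` is supported on `e, f`, with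
  -- common coefficient `P e + P p`. Pair it with the `X`-component of `z`.
  have key : ∀ z, comp s t X z (s e) + comp s t X z y = (P e + P p) *
      (comp s t X z (s e) + comp s t X z (t e) + (comp s t X z (s f) + comp s t X z (t f))) := by
    intro z
    have sum := sum_smul_bd s t (comp s t X z) (fun k => P k + κ k • P p)
    simp only [bd_add, bd_smul_const, hκ, hP, zero_smul, add_zero] at sum
    rw [expand] at sum
    swap
    · intro k hk
      by_cases hkX : k ∈ X
      · rw [comp_invariant hkX, add_self, zero_smul]
      · rw [hκX k hkX hk, hPK k (by rintro (h | h); exacts [hkX h, hk h]), zero_smul, add_zero,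
          smul_zero]
    simp only [hκK e heK, hκK f hfK, hκK p hpK, hκK q hqK, ← hPef, ← hPpq, smul_eq_mul,
      one_mul, add_self (P p), mul_zero, add_zero] at sum
    simp only [mul_add, Finset.sum_add_distrib, mul_ite, mul_one, mul_zero, Finset.sum_ite_eq,
      Finset.mem_univ, if_true] at sum
    rw [sum]
    ring
  -- Taking `z = s e` forces the coefficient to be 1. Then `z = t e` and `z = s f` place `y` in two
  -- distinct `X`-components: the four separated ends of `e` and `f` cannot have a boundary at only
  -- two places.
  have k1 := key (s e)
  have k2 := key (t e)
  have k3 := key (s f)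
  rw [comp_of_joined (.refl X _), comp_of_not_joined hyX, comp_of_not_joined n1,
    comp_of_not_joined n2, comp_of_not_joined n3] at k1
  have hr : P e + P p = 1 := by simpa using k1.symm
  rw [hr, comp_of_joined (.refl X _), comp_of_not_joined fun h => n1 h.symm,
    comp_of_not_joined n4, comp_of_not_joined n5] at k2
  rw [hr, comp_of_joined (.refl X _), comp_of_not_joined fun h => n2 h.symm,
    comp_of_not_joined fun h => n4 h.symm, comp_of_not_joined n6] at k3
  simp only [zero_add, one_mul, add_zero] at k2 k3
  exact n4 ((joined_of_comp_eq_one k2).trans (joined_of_comp_eq_one k3).symm)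

end Contract
-- From a flow to four cycles
section FourCycles

variable {V E : Type*} [Fintype V] [Fintype E] {s t : E → V}

open scoped Classical in
/-- If the ends of every edge are joined in the complement of the cycle `C`, then a nowhere-zero `ZMod 2 × ZMod 2`-flow of
the contraction of `C` gives four cycles that cover `C` once and all other edges twice. -/
theorem exists_four_cycles {C : Set E} (hconn : ∀ e, Joined s t Cᶜ (s e) (t e))
    (hC : ∀ x, bd s t (fun e => if e ∈ C then (1 : ZMod 2) else 0) x = 0)
    {g : E → ZMod 2 × ZMod 2} (hg : ∀ x, bd s t g x = 0) (hgC : ∀ e ∉ C, g e ≠ 0) :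
    ∃ Q : Fin 4 → E → ZMod 2, (∀ i x, bd s t (Q i) x = 0) ∧
      ∀ e, (Finset.univ.filter fun i => Q i e = 1).card = if e ∈ C then 1 else 2 := by
  -- On `C` the four weightings are to be the indicators of the four values of `g`, as polynomials
  -- in its coordinates; the first is the product. The weighting `h` off `C` makes this product
  -- closed. Off `C` the four differ from `h` by `0`, `g.1`, `g.2` and `g.1 + g.2`, of which exactly
  -- two are 1.
  obtain ⟨h, hhC, hh⟩ := exists_bd_eq (s := s) (t := t) Cᶜ
    (bd s t fun e => if e ∈ C then (g e).1 * (g e).2 else 0) (by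
      intro χ hχ
      rw [sum_smul_bd]
      refine Finset.sum_eq_zero fun e _ => ?_
      rw [(hconn e).eq_of_invariant χ hχ, add_self, zero_smul])
  have h1 : ∀ x, bd s t (fun e => (g e).1) x = 0 := fun x => by
    have := bd_linear s t (LinearMap.fst (ZMod 2) (ZMod 2) (ZMod 2)) g x
    rwa [hg, map_zero] at this
  have h2 : ∀ x, bd s t (fun e => (g e).2) x = 0 := fun x => by
    have := bd_linear s t (LinearMap.snd (ZMod 2) (ZMod 2) (ZMod 2)) g x
    rwa [hg, map_zero] at this
  let q : E → ZMod 2 := fun e => (if e ∈ C then (g e).1 * (g e).2 else 0) + h e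
  have hq : ∀ x, bd s t q x = 0 := fun x => by rw [bd_add, hh, add_self]
  refine ⟨![q, fun e => q e + (g e).1, fun e => q e + (g e).2,
    fun e => (q e + (g e).1) + ((g e).2 + if e ∈ C then 1 else 0)], fun i x => ?_, fun e => ?_⟩
  · fin_cases i
    · exact hq x
    · exact (bd_add s t q (fun e => (g e).1) x).trans (by rw [hq, h1, add_zero])
    · exact (bd_add s t q (fun e => (g e).2) x).trans (by rw [hq, h2, add_zero])
    · refine (bd_add s t (fun e => q e + (g e).1)
        (fun e => (g e).2 + if e ∈ C then 1 else 0) x).trans ?_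
      rw [bd_add, bd_add, hh, bd_add, h1, h2, hC, add_self]
      simp
  · have hge := hgC e
    have hhe := hhC e
    by_cases he : e ∈ C
    · have hh0 : h e = 0 := hhe (fun h' => h' he)
      have hcases : (Finset.univ.filter fun i => (![q, fun e => q e + (g e).1,
          fun e => q e + (g e).2, fun e => (q e + (g e).1) + ((g e).2 + if e ∈ C then 1 else 0)] :
          Fin 4 → E → ZMod 2) i e = 1) = Finset.univ.filter fun i =>
          (![(g e).1 * (g e).2, (g e).1 * (g e).2 + (g e).1, (g e).1 * (g e).2 + (g e).2,
          ((g e).1 * (g e).2 + (g e).1) + ((g e).2 + 1)] : Fin 4 → ZMod 2) i = 1 := by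
        ext i
        fin_cases i <;> simp [q, he, hh0]
      rw [hcases, if_pos he]
      clear * -
      generalize g e = m
      revert m
      decide
    · have hcases : (Finset.univ.filter fun i => (![q, fun e => q e + (g e).1,
          fun e => q e + (g e).2, fun e => (q e + (g e).1) + ((g e).2 + if e ∈ C then 1 else 0)] :
          Fin 4 → E → ZMod 2) i e = 1) = Finset.univ.filter fun i =>
          (![h e, h e + (g e).1, h e + (g e).2, (h e + (g e).1) + (g e).2] :
          Fin 4 → ZMod 2) i = 1 := by
        ext i
        fin_cases i <;> simp [q, he]
      rw [hcases, if_neg he]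
      have := hge he
      clear * - this
      generalize g e = m at *
      generalize h e = k
      revert m k
      decide

end FourCycles

/-! ### Merging the vertices outside a set; extending weightings to contracted edges -/

section Merge

variable {V V' E M : Type*} [Fintype V] [Fintype E] [AddCommGroup M] [Module (ZMod 2) M]
  {s t : E → V} {X : Set E} {W : Set V}

open scoped Classical in
theorem bd_comp (ρ : V → V') (f : E → M) (z : V') :
    bd (ρ ∘ s) (ρ ∘ t) f z = ∑ x, (if ρ x = z then (1 : ZMod 2) else 0) • bd s t f x := by
  rw [sum_smul_bd]
  rfl

theorem bd_comp_eq_zero (ρ : V → V') {f : E → M} (hf : ∀ x, bd s t f x = 0) (z : V') :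
    bd (ρ ∘ s) (ρ ∘ t) f z = 0 := by
  rw [bd_comp]
  simp [hf]

theorem Joined.comp (ρ : V → V') {x y : V} (h : Joined s t X x y) :
    Joined (ρ ∘ s) (ρ ∘ t) X (ρ x) (ρ y) := by
  classical
  obtain ⟨P, hP, h⟩ := h
  refine ⟨P, hP, fun z => ?_⟩
  rw [bd_comp]
  simp [h, mul_add, Finset.sum_add_distrib]

open scoped Classical in
/-- Identify all vertices outside `W` to a single new vertex. -/
noncomputable def merge (W : Set V) (x : V) : Option V := if x ∈ W then some x else none

omit [Fintype V] in
theorem merge_of_mem {x : V} (h : x ∈ W) : merge W x = some x := if_pos h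

omit [Fintype V] in
theorem merge_of_notMem {x : V} (h : x ∉ W) : merge W x = none := if_neg h

omit [Fintype V] in
theorem merge_eq_some_iff {x y : V} (hy : y ∈ W) : merge W x = some y ↔ x = y := by
  by_cases h : x ∈ W
  · rw [merge_of_mem h, Option.some_inj]
  · rw [merge_of_notMem h]
    exact ⟨fun h' => by simp at h', fun h' => absurd (h' ▸ hy) h⟩

omit [Fintype V] in
theorem bd_merge_some (f : E → M) {x : V} (hx : x ∈ W) :
    bd (merge W ∘ s) (merge W ∘ t) f (some x) = bd s t f x := by
  refine Finset.sum_congr rfl fun e _ => ?_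
  congr 1
  simp only [inc, Function.comp]
  congr 1 <;> congr 1 <;> exact propext (merge_eq_some_iff hx)

/-- No edge of `X` crosses the border of `W`, so the component indicator, set to 0 at the merged
vertex, remains invariant. -/
theorem joined_of_merge (hW : ∀ e ∈ X, s e ∈ W ↔ t e ∈ W) {x y : V} (hx : x ∈ W) (hy : y ∈ W)
    (h : Joined (merge W ∘ s) (merge W ∘ t) X (merge W x) (merge W y)) : Joined s t X x y := by
  have key := h.eq_of_invariant (fun o => o.elim 0 (comp s t X x)) fun e he => by
    simp only [Function.comp]
    by_cases hs : s e ∈ W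
    · rw [merge_of_mem hs, merge_of_mem ((hW e he).1 hs)]
      exact comp_invariant he
    · rw [merge_of_notMem hs, merge_of_notMem fun h => hs ((hW e he).2 h)]
  rw [merge_of_mem hx, merge_of_mem hy] at key
  simp only [Option.elim] at key
  rw [comp_of_joined (.refl X x)] at key
  exact joined_of_comp_eq_one key.symm

/-- A weighting of the edges outside `X` that is conserved at the vertices in `A` of the
contraction of `X` extends to the edges in `X`. -/
theorem exists_extension {γ : Type*} {π : V → γ}
    (hπ : ∀ x y, π x = π y → Joined s t X x y) (A : Set γ) (f : E → M)
    (hf : ∀ a ∈ A, bd (π ∘ s) (π ∘ t) f a = 0) :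
    ∃ f' : E → M, (∀ e ∉ X, f' e = f e) ∧
      ∀ z, bd (merge (π ⁻¹' A) ∘ s) (merge (π ⁻¹' A) ∘ t) f' z = 0 := by
  classical
  obtain ⟨h, hhX, hh⟩ := exists_bd_eq (s := merge (π ⁻¹' A) ∘ s) (t := merge (π ⁻¹' A) ∘ t) X
    (bd (merge (π ⁻¹' A) ∘ s) (merge (π ⁻¹' A) ∘ t) f) (by
      intro χ hχ
      rw [sum_smul_bd]
      -- The added constant changes no difference along an edge but makes the test function vanish
      -- outside the preimage of `A`. Being constant on the fibres of `π`, it descends to the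
      -- contraction, where `f` is conserved on `A`.
      obtain ⟨χ₀, hχ₀⟩ : ∃ χ₀ : V → ZMod 2, ∀ x, χ₀ x = χ (merge (π ⁻¹' A) x) + χ none :=
        ⟨_, fun _ => rfl⟩
      have hfac : Function.FactorsThrough χ₀ π := fun x y hxy => by
        rw [hχ₀, hχ₀, ((hπ x y hxy).comp (merge (π ⁻¹' A))).eq_of_invariant χ hχ]
      have := sum_smul_bd_of_mem (π ∘ s) (π ∘ t) (Finset.univ.image π) (by simp)
        (Function.extend π χ₀ 0) f
      rw [Finset.sum_eq_zero] at this
      · refine Eq.trans (Finset.sum_congr rfl fun e _ => ?_) this.symm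
        congr 1
        simp only [Function.comp, hfac.extend_apply, hχ₀]
        have := add_self (χ none)
        linear_combination -this
      · intro a ha
        obtain ⟨x, -, rfl⟩ := Finset.mem_image.1 ha
        by_cases hx : π x ∈ A
        · rw [hf _ hx, smul_zero]
        · rw [hfac.extend_apply, hχ₀, merge_of_notMem (W := π ⁻¹' A) hx, add_self, zero_smul])
  refine ⟨fun e => f e + h e, fun e he => by simp [hhX e he], fun z => ?_⟩
  rw [bd_add, hh, add_self]

end Merge
end EdgeSpace

/-! ### Circuits of length four; encoding graphs by end maps -/

namespace Graph

/-- A loop would use up the degree of its vertex and be the whole circuit. Two adjacent vertices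
meet at most 2 + 2 - 1 edges, so a fourth edge avoids both. -/
theorem IsCircuit.exists_disjoint_edges {α β : Type*} {K : Graph α β} (hK : K.IsCircuit)
    (h4 : E(K).ncard = 4) : ∃ e x y f z w, K.IsLink e x y ∧ K.IsLink f z w ∧
      x ≠ y ∧ x ≠ z ∧ x ≠ w ∧ y ≠ z ∧ y ≠ w ∧ z ≠ w := by
  have hfin : E(K).Finite := Set.finite_of_ncard_ne_zero (by omega)
  have hNfin : ∀ v, {e | K.IsNonloopAt e v}.Finite := fun v =>
    hfin.subset fun e he => he.edge_mem
  have hLfin : ∀ v, {e | K.IsLoopAt e v}.Finite := fun v =>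
    hfin.subset fun e he => he.edge_mem
  have hloop : ∀ d v, ¬ K.IsLoopAt d v := by
    intro d v hd
    have hdeg := hK.2 v hd.vertex_mem
    have hpos : 0 < {e | K.IsLoopAt e v}.ncard := (Set.ncard_pos (hLfin v)).2 ⟨d, hd⟩
    unfold deg at hdeg
    have hN : {e | K.IsNonloopAt e v} = ∅ := (Set.ncard_eq_zero (hNfin v)).1 (by omega)
    have hreach : ∀ a, Relation.ReflTransGen K.Adj v a → a = v := by
      intro a ha
      induction ha with
      | refl => rfl
      | tail _ hbc ih =>
        subst ih
        obtain ⟨e, he⟩ := hbc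
        by_contra hne
        have : e ∈ {e | K.IsNonloopAt e _} := ⟨_, hne, he⟩
        rw [hN] at this
        exact this
    have hsub : E(K) ⊆ {e | K.IsLoopAt e v} := by
      intro e he
      obtain ⟨x, y, hxy⟩ := exists_isLink_of_mem_edgeSet he
      have hx := hreach x (hK.1.2 v hd.vertex_mem x hxy.left_mem)
      have hy := hreach y (hK.1.2 v hd.vertex_mem y hxy.right_mem)
      subst hx
      rw [hy] at hxy
      exact hxy
    have := Set.ncard_le_ncard hsub (hLfin v)
    omega
  have hN : ∀ v ∈ V(K), {e | K.IsNonloopAt e v}.ncard = 2 := by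
    intro v hv
    have hdeg := hK.2 v hv
    have h0 : {e | K.IsLoopAt e v} = ∅ := Set.eq_empty_of_forall_notMem fun e => hloop e v
    unfold deg at hdeg
    rw [h0, Set.ncard_empty] at hdeg
    omega
  obtain ⟨e, he⟩ : E(K).Nonempty := Set.nonempty_of_ncard_ne_zero (by omega)
  obtain ⟨x, y, hxy⟩ := exists_isLink_of_mem_edgeSet he
  have hne : ∀ {d a b}, K.IsLink d a b → a ≠ b := by
    rintro d a b h rfl
    exact hloop _ _ h
  have hcard := Set.ncard_union_add_ncard_inter {e | K.IsNonloopAt e x} {e | K.IsNonloopAt e y}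
    (hNfin x) (hNfin y)
  have hpos : 0 < ({e | K.IsNonloopAt e x} ∩ {e | K.IsNonloopAt e y}).ncard :=
    (Set.ncard_pos ((hNfin x).inter_of_left _)).2
      ⟨e, ⟨y, (hne hxy).symm, hxy⟩, ⟨x, hne hxy, hxy.symm⟩⟩
  rw [hN x hxy.left_mem, hN y hxy.right_mem] at hcard
  obtain ⟨f, hf, hfn⟩ := Set.exists_mem_notMem_of_ncard_lt_ncard
    (s := {e | K.IsNonloopAt e x} ∪ {e | K.IsNonloopAt e y}) (t := E(K)) (by omega)
    ((hNfin x).union (hNfin y))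
  obtain ⟨z, w, hzw⟩ := exists_isLink_of_mem_edgeSet hf
  refine ⟨e, x, y, f, z, w, hxy, hzw, hne hxy, ?_, ?_, ?_, ?_, hne hzw⟩
  · rintro rfl
    exact hfn (.inl ⟨w, (hne hzw).symm, hzw⟩)
  · rintro rfl
    exact hfn (.inl ⟨z, hne hzw, hzw.symm⟩)
  · rintro rfl
    exact hfn (.inr ⟨w, (hne hzw).symm, hzw⟩)
  · rintro rfl
    exact hfn (.inr ⟨z, hne hzw, hzw.symm⟩)

end Graph

open EdgeSpace

namespace Graph

/-- The functions `s`, `t` (ends) and `ι` (labels) describe the edges of `H`, indexed by `D`. -/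
structure Encodes {α β E : Type*} (H : Graph α β) (s t : E → α) (ι : E → β) (D : Set E) :
    Prop where
  inj : Function.Injective ι
  mem_iff : ∀ d, d ∈ E(H) ↔ ∃ e ∈ D, ι e = d
  isLink : ∀ e ∈ D, H.IsLink (ι e) (s e) (t e)

section Degree

variable {α β E : Type*} {H C : Graph α β} {s t : E → α} {ι : E → β} {D : Set E}

theorem Encodes.mem (h : Encodes H s t ι D) {e : E} (he : ι e ∈ E(H)) : e ∈ D := by
  obtain ⟨e', he', h'⟩ := (h.mem_iff _).1 he
  exact h.inj h' ▸ he'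

theorem Encodes.isLink_iff (h : Encodes H s t ι D) (hC : C ≤ H) {e : E} (he : ι e ∈ E(C))
    {x y : α} : C.IsLink (ι e) x y ↔ (s e = x ∧ t e = y) ∨ (s e = y ∧ t e = x) := by
  rw [hC.isLink_iff he]
  exact (h.isLink e (h.mem (hC.edgeSet_mono he))).isLink_iff

theorem Encodes.exists_eq (h : Encodes H s t ι D) (hC : C ≤ H) {d : β} (hd : d ∈ E(C)) :
    ∃ e ∈ D, ι e = d :=
  (h.mem_iff d).1 (hC.edgeSet_mono hd)

open scoped Classical in
theorem Encodes.deg_eq [Fintype E] (h : Encodes H s t ι D) (hC : C ≤ H) (a : α) :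
    C.deg a = (Finset.univ.filter fun e => ι e ∈ E(C) ∧ ¬ (s e = a ↔ t e = a)).card +
      2 * (Finset.univ.filter fun e => ι e ∈ E(C) ∧ s e = a ∧ t e = a).card := by
  have h1 : {d | C.IsNonloopAt d a} =
      ι '' (Finset.univ.filter fun e => ι e ∈ E(C) ∧ ¬ (s e = a ↔ t e = a)) := by
    ext d
    simp only [Set.mem_ofPred_eq, Set.mem_image, Finset.coe_filter, Finset.mem_univ, true_and]
    constructor
    · rintro hd
      obtain ⟨e, -, rfl⟩ := h.exists_eq hC hd.edge_mem
      refine ⟨e, ⟨hd.edge_mem, ?_⟩, rfl⟩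
      obtain ⟨b, hb, hl⟩ := hd
      rcases (h.isLink_iff hC hl.edge_mem).1 hl with ⟨h1, h2⟩ | ⟨h1, h2⟩ <;> simp [h1, h2, hb]
    · rintro ⟨e, ⟨he, hst⟩, rfl⟩
      by_cases hs : s e = a
      · exact ⟨t e, fun ht => hst (by simp [hs, ht]), (h.isLink_iff hC he).2 (.inl ⟨hs, rfl⟩)⟩
      · have ht : t e = a := by
          by_contra ht
          exact hst (by simp [hs, ht])
        exact ⟨s e, hs, (h.isLink_iff hC he).2 (.inr ⟨rfl, ht⟩)⟩
  have h2 : {d | C.IsLoopAt d a} =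
      ι '' (Finset.univ.filter fun e => ι e ∈ E(C) ∧ s e = a ∧ t e = a) := by
    ext d
    simp only [Set.mem_ofPred_eq, Set.mem_image, Finset.coe_filter, Finset.mem_univ, true_and]
    constructor
    · rintro hd
      obtain ⟨e, -, rfl⟩ := h.exists_eq hC hd.edge_mem
      refine ⟨e, ⟨hd.edge_mem, ?_⟩, rfl⟩
      rcases (h.isLink_iff hC hd.edge_mem).1 hd with h | h <;> exact h
    · rintro ⟨e, ⟨he, hst⟩, rfl⟩
      exact (h.isLink_iff hC he).2 (.inl hst)
  rw [deg, h1, h2, Set.ncard_image_of_injective _ h.inj, Set.ncard_image_of_injective _ h.inj,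
    Set.ncard_coe_finset, Set.ncard_coe_finset]

open scoped Classical in
theorem Encodes.deg_cast [Fintype E] (h : Encodes H s t ι D) (hC : C ≤ H) (a : α) :
    (C.deg a : ZMod 2) = bd s t (fun e => if ι e ∈ E(C) then (1 : ZMod 2) else 0) a := by
  rw [h.deg_eq hC]
  push_cast
  rw [show (2 : ZMod 2) = 0 by decide, zero_mul, add_zero, Finset.natCast_card_filter]
  refine Finset.sum_congr rfl fun e _ => ?_
  by_cases he : ι e ∈ E(C) <;> by_cases hs : s e = a <;> by_cases ht : t e = a <;>
    simp [inc, he, hs, ht]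
  decide

theorem deg_eq_zero {a : α} (ha : a ∉ V(C)) : C.deg a = 0 := by
  have h1 : {d | C.IsNonloopAt d a} = ∅ :=
    Set.eq_empty_of_forall_notMem fun d hd => ha hd.vertex_mem
  have h2 : {d | C.IsLoopAt d a} = ∅ :=
    Set.eq_empty_of_forall_notMem fun d hd => ha hd.vertex_mem
  rw [deg, h1, h2, Set.ncard_empty]

open scoped Classical in
theorem Encodes.isEvenCycle_iff [Fintype E] (h : Encodes H s t ι D) (hC : C ≤ H) :
    C.IsEvenCycle ↔ ∀ a, bd s t (fun e => if ι e ∈ E(C) then (1 : ZMod 2) else 0) a = 0 := by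
  constructor
  · intro hE a
    rw [← h.deg_cast hC, ZMod.natCast_eq_zero_iff_even]
    by_cases ha : a ∈ V(C)
    · exact hE a ha
    · rw [deg_eq_zero ha]
      exact Even.zero
  · intro hb a _
    rw [← ZMod.natCast_eq_zero_iff_even, h.deg_cast hC, hb]

end Degree

/-- `G'` is the contraction of `X` in the graph with ends `s` and `t`, with quotient map `π`. -/
structure Represents {α β V E : Type*} [Fintype E] (G' : Graph α β) (s t : E → V) (ι : E → β)
    (X : Set E) (π : V → α) : Prop where
  enc : Encodes G' (π ∘ s) (π ∘ t) ι Xᶜ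
  range_eq : Set.range π = V(G')
  eq_iff : ∀ x y, π x = π y ↔ Joined s t X x y

/-! ### Iterated contractions over a fixed edge set -/

section Represents

variable {α β V E : Type*} [Fintype V] [Fintype E] {G' : Graph α β} {s t : E → V} {ι : E → β}
  {X : Set E} {π : V → α}

theorem Represents.contract (h : Represents G' s t ι X π) (F : Set β) :
    Represents (G'.contract F) s t ι (X ∪ ι ⁻¹' F) (G'.contractRep F ∘ π) := by
  classical
  refine ⟨⟨h.enc.inj, fun d => ?_, fun e he => ?_⟩, ?_, fun x y => ?_⟩
  · simp only [Graph.contract, edgeSet_map, edgeSet_deleteEdges, Set.mem_sdiff, h.enc.mem_iff]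
    constructor
    · rintro ⟨⟨e, he, rfl⟩, hF⟩
      exact ⟨e, by rintro (h | h); exacts [he h, hF h], rfl⟩
    · rintro ⟨e, he, rfl⟩
      exact ⟨⟨e, fun h => he (.inl h), rfl⟩, fun h => he (.inr h)⟩
  · refine IsLink.map _ ?_
    rw [deleteEdges_isLink]
    exact ⟨h.enc.isLink e fun h => he (.inl h), fun h => he (.inr h)⟩
  · rw [Set.range_comp, h.range_eq]
    simp [Graph.contract]
  · rw [Function.comp, Function.comp, contractRep_eq_iff]
    constructor
    · intro hxy
      have key : ∀ a b, Relation.EqvGen (G'.restrict F).Adj a b →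
          a = b ∨ ∃ x y, π x = a ∧ π y = b ∧ Joined s t (X ∪ ι ⁻¹' F) x y := by
        intro a b hab
        induction hab with
        | rel a b hab =>
          obtain ⟨d, hdF, hl⟩ := hab
          obtain ⟨e, he, rfl⟩ := (h.enc.mem_iff d).1 hl.edge_mem
          have hj : Joined s t (X ∪ ι ⁻¹' F) (s e) (t e) := .of_mem (.inr hdF)
          right
          rcases (h.enc.isLink_iff le_rfl hl.edge_mem).1 hl with ⟨h1, h2⟩ | ⟨h1, h2⟩
          · exact ⟨_, _, h1, h2, hj⟩
          · exact ⟨_, _, h2, h1, hj.symm⟩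
        | refl a => exact .inl rfl
        | symm a b _ ih =>
          rcases ih with rfl | ⟨x, y, hx, hy, hxy⟩
          · exact .inl rfl
          · exact .inr ⟨y, x, hy, hx, hxy.symm⟩
        | trans a b c _ _ ih₁ ih₂ =>
          rcases ih₁ with rfl | ⟨x, y, hx, hy, hxy⟩
          · exact ih₂
          rcases ih₂ with rfl | ⟨z, w, hz, hw, hzw⟩
          · exact .inr ⟨x, y, hx, hy, hxy⟩
          · refine .inr ⟨x, w, hx, hw, hxy.trans (.trans ?_ hzw)⟩
            exact ((h.eq_iff y z).1 (hy.trans hz.symm)).mono Set.subset_union_left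
      have hmono : ∀ {x y}, π x = π y → Joined s t (X ∪ ι ⁻¹' F) x y := fun hxy =>
        ((h.eq_iff _ _).1 hxy).mono Set.subset_union_left
      rcases key _ _ hxy with hxy | ⟨x', y', hx, hy, hxy⟩
      · exact hmono hxy
      · exact (hmono hx.symm).trans (hxy.trans (hmono hy))
    · intro hxy
      have := hxy.eq_of_invariant
        (fun z => if Relation.EqvGen (G'.restrict F).Adj (π x) (π z) then 1 else 0) (by
          intro e he
          have hst : Relation.EqvGen (G'.restrict F).Adj (π (s e)) (π (t e)) := by
            by_cases heX : e ∈ X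
            · rw [(h.eq_iff (s e) (t e)).2 (.of_mem heX)]
              exact .refl _
            · exact .rel _ _ ⟨ι e, he.resolve_left heX, h.enc.isLink e heX⟩
          have : Relation.EqvGen (G'.restrict F).Adj (π x) (π (s e)) ↔
              Relation.EqvGen (G'.restrict F).Adj (π x) (π (t e)) :=
            ⟨fun h => h.trans _ _ _ hst, fun h => h.trans _ _ _ (hst.symm _ _)⟩
          simp only [this])
      by_contra hn
      simp [hn, Relation.EqvGen.refl] at this

omit [Fintype V] in
theorem Represents.joined_of_reachable (h : Represents G' s t ι X π) {K : Graph α β} (hK : K ≤ G')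
    {a b : α} (hab : Relation.ReflTransGen K.Adj a b) {x : V} (hx : π x = a) :
    ∀ y, π y = b → Joined s t (X ∪ ι ⁻¹' E(K)) x y := by
  have hmono : ∀ {x y}, π x = π y → Joined s t (X ∪ ι ⁻¹' E(K)) x y := fun hxy =>
    ((h.eq_iff _ _).1 hxy).mono Set.subset_union_left
  induction hab with
  | refl => exact fun y hy => hmono (hx.trans hy.symm)
  | tail _ hbc ih =>
    intro y hy
    obtain ⟨d, hd⟩ := hbc
    obtain ⟨e, he, rfl⟩ := h.enc.exists_eq hK hd.edge_mem
    have hj : Joined s t (X ∪ ι ⁻¹' E(K)) (s e) (t e) := .of_mem (.inr hd.edge_mem)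
    rcases (h.enc.isLink_iff hK hd.edge_mem).1 hd with ⟨h1, h2⟩ | ⟨h1, h2⟩
    · exact (ih _ h1).trans (hj.trans (hmono (h2.trans hy.symm)))
    · exact (ih _ h2).trans (hj.symm.trans (hmono (h1.trans hy.symm)))

/-- There is a `ZMod 2 × ZMod 2`-flow that does not vanish outside `X`, where the vertices outside
`W` are identified. -/
def HasFlow {V E : Type*} [Fintype E] (s t : E → V) (X : Set E) (W : Set V) : Prop :=
  ∃ g : E → ZMod 2 × ZMod 2, (∀ z, bd (merge W ∘ s) (merge W ∘ t) g z = 0) ∧ ∀ e ∉ X, g e ≠ 0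

theorem Represents.hasFlow_of_circuit (h : Represents G' s t ι X π) {K : Graph α β} (hK : K ≤ G')
    (hcirc : K.IsCircuit) (hcard : E(K).ncard ≤ 4) (A : Set α)
    (hA : ∀ a ∈ V(K), ∀ b ∈ V(K), a ∈ A → b ∈ A)
    (hflow : HasFlow s t (X ∪ ι ⁻¹' E(K)) (π ⁻¹' A)) : HasFlow s t X (π ⁻¹' A) := by
  classical
  obtain ⟨g, hg, hgX⟩ := hflow
  set W := π ⁻¹' A with hW
  let T : Finset E := Finset.univ.filter fun e => ι e ∈ E(K)
  have hT : ∀ e, e ∈ T ↔ ι e ∈ E(K) := fun e => by simp [T]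
  have hTX : ∀ e ∈ T, e ∉ X := fun e he => h.enc.mem (hK.edgeSet_mono ((hT e).1 he))
  have hTcoe : (T : Set E) = ι ⁻¹' E(K) := by
    ext e
    simp [T]
  have hTcard : T.card = E(K).ncard := by
    rw [← Set.ncard_coe_finset, hTcoe, ← Set.ncard_image_of_injective _ h.enc.inj]
    congr 1
    refine Set.image_preimage_eq_of_subset fun d hd => ?_
    obtain ⟨e, -, he⟩ := h.enc.exists_eq hK hd
    exact ⟨e, he⟩
  have hsV : ∀ e ∈ T, π (s e) ∈ V(K) ∧ π (t e) ∈ V(K) := fun e he => by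
    have hl : K.IsLink (ι e) (π (s e)) (π (t e)) :=
      (h.enc.isLink_iff hK ((hT e).1 he)).2 (.inl ⟨rfl, rfl⟩)
    exact ⟨hl.left_mem, hl.right_mem⟩
  have hgT : ∀ e ∉ X, e ∉ T → g e ≠ 0 := fun e heX heT => hgX e (by
    rintro (h' | h')
    exacts [heX h', heT ((hT e).2 h')])
  by_cases hin : ∀ e ∈ T, s e ∈ W ∧ t e ∈ W
  · have hWX : ∀ e ∈ X, s e ∈ W ↔ t e ∈ W := fun e he => by
      rw [hW, Set.mem_preimage, Set.mem_preimage, (h.eq_iff (s e) (t e)).2 (.of_mem he)]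
    obtain ⟨κ, hκ1, hκ2⟩ := exists_extension (s := s) (t := t) (X := X)
      (fun x y => (h.eq_iff x y).1) A (fun e => if ι e ∈ E(K) then (1 : ZMod 2) else 0)
      (fun a _ => (h.enc.isEvenCycle_iff hK).1 (fun v hv => by rw [hcirc.2 v hv]; decide) a)
    refine exists_flow_of_contract_circuit (K := T) (κ := κ) hTX (hTcard ▸ hcard) hκ2
      (fun e he => ?_) (fun e heX heT => ?_) (fun e he e' he' => ?_) (fun h4 => ?_) hg hgT
    · rw [hκ1 e (hTX e he), if_pos ((hT e).1 he)]
    · rw [hκ1 e heX, if_neg fun h' => heT ((hT e).2 h')]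
    · rw [hTcoe]
      exact (h.joined_of_reachable hK
        (hcirc.1.2 _ (hsV e he).1 _ (hsV e' he').1) rfl _ rfl).comp (merge W)
    · obtain ⟨d, x, y, d', z, w, hd, hd', hxy, hxz, hxw, hyz, hyw, hzw⟩ :=
        hcirc.exists_disjoint_edges (hTcard ▸ h4)
      obtain ⟨e, -, rfl⟩ := h.enc.exists_eq hK hd.edge_mem
      obtain ⟨f, -, rfl⟩ := h.enc.exists_eq hK hd'.edge_mem
      have heT := (hT e).2 hd.edge_mem
      have hfT := (hT f).2 hd'.edge_mem
      have hnj : ∀ u v, u ∈ W → v ∈ W → π u ≠ π v →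
          ¬ Joined (merge W ∘ s) (merge W ∘ t) X (merge W u) (merge W v) :=
        fun u v hu hv huv hj => huv ((h.eq_iff u v).2 (joined_of_merge hWX hu hv hj))
      obtain ⟨hse, hte⟩ := hin e heT
      obtain ⟨hsf, htf⟩ := hin f hfT
      have hne : π (s e) ≠ π (t e) ∧ π (s e) ≠ π (s f) ∧ π (s e) ≠ π (t f) ∧
          π (t e) ≠ π (s f) ∧ π (t e) ≠ π (t f) ∧ π (s f) ≠ π (t f) := by
        have h1 := (h.enc.isLink_iff hK hd.edge_mem).1 hd
        have h2 := (h.enc.isLink_iff hK hd'.edge_mem).1 hd'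
        simp only [Function.comp] at h1 h2
        grind
      obtain ⟨n1, n2, n3, n4, n5, n6⟩ := hne
      exact ⟨e, heT, f, hfT, hnj _ _ hse hte n1, hnj _ _ hse hsf n2, hnj _ _ hse htf n3,
        hnj _ _ hte hsf n4, hnj _ _ hte htf n5, hnj _ _ hsf htf n6⟩
  -- Here the circuit lies wholly in the merged part, where its edges are loops and may carry any
  -- nonzero value.
  · have hout : ∀ e ∈ T, s e ∉ W ∧ t e ∉ W := by
      push Not at hin
      obtain ⟨e, heT, he⟩ := hin
      have hv : ∃ v ∈ V(K), v ∉ A := by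
        by_cases hs : s e ∈ W
        · exact ⟨_, (hsV e heT).2, he hs⟩
        · exact ⟨_, (hsV e heT).1, hs⟩
      obtain ⟨v, hvK, hvA⟩ := hv
      exact fun f hf => ⟨fun h' => hvA (hA _ (hsV f hf).1 v hvK h'),
        fun h' => hvA (hA _ (hsV f hf).2 v hvK h')⟩
    refine ⟨fun e => if e ∈ T then (1, 1) else g e, fun z => ?_, fun e heX => ?_⟩
    · rw [← hg z]
      refine Finset.sum_congr rfl fun e _ => ?_
      by_cases he : e ∈ T
      · have : inc (merge W ∘ s) (merge W ∘ t) z e = 0 := by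
          rw [inc, Function.comp, Function.comp, merge_of_notMem (hout e he).1,
            merge_of_notMem (hout e he).2, add_self]
        rw [this, zero_smul, zero_smul]
      · dsimp only
        rw [if_neg he]
    · dsimp only
      by_cases he : e ∈ T
      · rw [if_pos he]
        decide
      · rw [if_neg he]
        exact hgT e heX he

/-- Sets `A` of vertices of the final graph are used because each circuit contracted earlier lies in
a single fibre, hence entirely inside or entirely outside the preimage of `A`. -/
theorem Represents.exists_of_contractsCircuit {G₂ : Graph α β} (h : Represents G' s t ι X π)
    (hG : Relation.ReflTransGen (ContractsCircuit 4) G' G₂) :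
    ∃ X' π', X ⊆ X' ∧ Represents G₂ s t ι X' π' ∧
      ∀ A : Set α, HasFlow s t X' (π' ⁻¹' A) → HasFlow s t X (π' ⁻¹' A) := by
  induction hG with
  | refl => exact ⟨X, π, subset_rfl, h, fun _ => id⟩
  | tail _ hstep ih =>
    obtain ⟨X', π', hXX', h', hfl⟩ := ih
    obtain ⟨K, hK, hcirc, hcard, rfl⟩ := hstep
    refine ⟨_, _, hXX'.trans Set.subset_union_left, h'.contract E(K), fun A hA => ?_⟩
    rw [Set.preimage_comp] at hA ⊢
    refine hfl _ (h'.hasFlow_of_circuit hK hcirc hcard _ ?_ hA)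
    intro a ha b hb haA
    obtain ⟨x, rfl⟩ : a ∈ Set.range π' := by
      rw [h'.range_eq]
      exact hK.vertexSet_mono ha
    obtain ⟨y, rfl⟩ : b ∈ Set.range π' := by
      rw [h'.range_eq]
      exact hK.vertexSet_mono hb
    have hxy := ((h'.contract E(K)).eq_iff x y).2
      (h'.joined_of_reachable hK (hcirc.1.2 _ ha _ hb) rfl _ rfl)
    rw [Set.mem_preimage] at haA ⊢
    exact (congrArg (· ∈ A) hxy).mp haA

end Represents
end Graph

namespace EdgeSpace

/-! ### Double cover patterns at a vertex of degree at most three -/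

section Pattern

/-- The sum of `q` over the fibres of `p`. -/
def fibreSum {m n : ℕ} (p : Fin m → Fin n) (q : Fin m → ZMod 2) (j : Fin n) : ZMod 2 :=
  ∑ i ∈ Finset.univ.filter (p · = j), q i

variable {m n : ℕ} {p : Fin m → Fin n}

theorem fibreSum_apply (hp : Function.Injective p) (q : Fin m → ZMod 2) (i : Fin m) :
    fibreSum p q (p i) = q i := by
  rw [fibreSum, Finset.sum_eq_single i]
  · intro j hj hji
    exact absurd (hp (Finset.mem_filter.1 hj).2) hji
  · intro h
    simp at h

theorem fibreSum_of_notMem (q : Fin m → ZMod 2) {j : Fin n} (hj : ∀ i, p i ≠ j) :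
    fibreSum p q j = 0 :=
  Finset.sum_eq_zero fun i hi => absurd (Finset.mem_filter.1 hi).2 (hj i)

theorem ones_fibreSum (hp : Function.Injective p) (q : Fin m → ZMod 2) :
    (Finset.univ.filter fun j => fibreSum p q j = 1) =
      (Finset.univ.filter fun i => q i = 1).image p := by
  ext j
  simp only [Finset.mem_filter, Finset.mem_univ, true_and, Finset.mem_image]
  by_cases h : ∃ i, p i = j
  · obtain ⟨i, rfl⟩ := h
    rw [fibreSum_apply hp]
    exact ⟨fun h => ⟨i, h, rfl⟩, fun ⟨i', h, h'⟩ => hp h' ▸ h⟩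
  · push Not at h
    rw [fibreSum_of_notMem q h]
    exact ⟨fun h => absurd h (by decide), fun ⟨i, _, hi⟩ => absurd hi (h i)⟩

theorem card_ones_fibreSum (hp : Function.Injective p) (q : Fin m → ZMod 2) :
    (Finset.univ.filter fun j => fibreSum p q j = 1).card =
      (Finset.univ.filter fun i => q i = 1).card := by
  rw [ones_fibreSum hp, Finset.card_image_of_injective _ hp]

theorem eq_of_one_iff : ∀ {x y : ZMod 2}, (x = 1 ↔ y = 1) → x = y := by
  decide

theorem eq_of_ones_eq {f g : Fin n → ZMod 2}
    (h : (Finset.univ.filter fun j => f j = 1) = Finset.univ.filter fun j => g j = 1) :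
    f = g := by
  funext j
  exact eq_of_one_iff (by simpa using congrArg (j ∈ ·) h)

/-- Equal counts leave no room for ones of `f` outside the range of `p`. -/
theorem eq_fibreSum (hp : Function.Injective p) {f : Fin n → ZMod 2} {q : Fin m → ZMod 2}
    (hfq : ∀ i, f (p i) = q i) (hcard : (Finset.univ.filter fun j => f j = 1).card =
      (Finset.univ.filter fun i => q i = 1).card) : f = fibreSum p q := by
  apply eq_of_ones_eq
  rw [ones_fibreSum hp]
  refine (Finset.eq_of_subset_of_card_le (fun j hj => ?_) ?_).symm
  · obtain ⟨i, hi, rfl⟩ := Finset.mem_image.1 hj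
    simpa [hfq] using hi
  · rw [hcard, Finset.card_image_of_injective _ hp]

theorem exists_injective_extension {k : ℕ} (hk : 4 ≤ k) {a' b' c' : Fin 4} {a b c : Fin k}
    (hab' : a' ≠ b') (hac' : a' ≠ c') (hbc' : b' ≠ c') (hab : a ≠ b) (hac : a ≠ c)
    (hbc : b ≠ c) : ∃ p : Fin 4 → Fin k, Function.Injective p ∧ p a' = a ∧ p b' = b ∧ p c' = c := by
  obtain ⟨d, hd⟩ : ∃ d, d ∉ ({a, b, c} : Finset (Fin k)) := by
    by_contra! h
    have := Finset.card_le_three (a := a) (b := b) (c := c)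
    rw [Finset.eq_univ_iff_forall.2 h, Finset.card_univ, Fintype.card_fin] at this
    omega
  simp only [Finset.mem_insert, Finset.mem_singleton, not_or] at hd
  obtain ⟨hda, hdb, hdc⟩ := hd
  refine ⟨fun i => if i = a' then a else if i = b' then b else if i = c' then c else d,
    fun i j hij => ?_, by simp, by simp [hab'.symm], by simp [hac'.symm, hbc'.symm]⟩
  have hfour : ∀ i j a' b' c' : Fin 4, a' ≠ b' → a' ≠ c' → b' ≠ c' → i ≠ a' → i ≠ b' → i ≠ c' →
    j ≠ a' → j ≠ b' → j ≠ c' → i = j := by decide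
  have := hfour i j a' b' c' hab' hac' hbc'
  dsimp only at hij
  split_ifs at hij <;> simp_all

theorem exists_pair {f : Fin n → ZMod 2}
    (hf : (Finset.univ.filter fun j => f j = 1).card = 2) :
    ∃ a b, a ≠ b ∧ ∀ j, f j = 1 ↔ j = a ∨ j = b := by
  obtain ⟨a, b, hab, h⟩ := Finset.card_eq_two.1 hf
  refine ⟨a, b, hab, fun j => ?_⟩
  simpa using congrArg (j ∈ ·) h

/-- Two pairs whose symmetric difference is again a pair share exactly one element. -/
theorem exists_triple {f g : Fin n → ZMod 2}
    (hf : (Finset.univ.filter fun j => f j = 1).card = 2)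
    (hg : (Finset.univ.filter fun j => g j = 1).card = 2)
    (hfg : (Finset.univ.filter fun j => f j + g j = 1).card = 2) :
    ∃ a b c, a ≠ b ∧ a ≠ c ∧ b ≠ c ∧ (∀ j, f j = 1 ↔ j = a ∨ j = b) ∧
      ∀ j, g j = 1 ↔ j = a ∨ j = c := by
  obtain ⟨a, b, hab, hfj⟩ := exists_pair hf
  obtain ⟨c, d, hcd, hgj⟩ := exists_pair hg
  obtain ⟨u, v, huv, hfgj⟩ := exists_pair hfg
  have h01 : ∀ x y : ZMod 2, x + y = 1 ↔ ¬ (x = 1 ↔ y = 1) := by decide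
  simp only [h01, hfj, hgj] at hfgj
  have ha := hfgj a
  have hb := hfgj b
  have hc := hfgj c
  have hd := hfgj d
  have hu := hfgj u
  have hv := hfgj v
  by_cases hac : a = c
  · subst hac
    refine ⟨a, b, d, hab, hcd, ?_, hfj, hgj⟩
    grind
  by_cases had : a = d
  · subst had
    refine ⟨a, b, c, hab, hcd.symm, ?_, hfj, fun j => (hgj j).trans or_comm⟩
    grind
  by_cases hbc : b = c
  · subst hbc
    refine ⟨b, a, d, hab.symm, hcd, had, fun j => (hfj j).trans or_comm, hgj⟩
  by_cases hbd : b = d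
  · subst hbd
    exact ⟨b, a, c, hab.symm, hcd.symm, hac, fun j => (hfj j).trans or_comm,
      fun j => (hgj j).trans or_comm⟩
  grind

theorem eq_of_pair {k : ℕ} {p : Fin 4 → Fin k} (hp : Function.Injective p) {f : Fin k → ZMod 2}
    {q : Fin 4 → ZMod 2} {a b : Fin 4} (hq : ∀ i, q i = 1 ↔ i = a ∨ i = b)
    (hf : ∀ j, f j = 1 ↔ j = p a ∨ j = p b) (i : Fin 4) : f (p i) = q i :=
  eq_of_one_iff (by rw [hq, hf, hp.eq_iff, hp.eq_iff])

theorem exists_matching_pair {k : ℕ} (hk : 4 ≤ k) {f : Fin k → ZMod 2} {q : Fin 4 → ZMod 2}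
    (hf : (Finset.univ.filter fun j => f j = 1).card = 2)
    (hq : (Finset.univ.filter fun j => q j = 1).card = 2) :
    ∃ p : Fin 4 → Fin k, Function.Injective p ∧ ∀ i, f (p i) = q i := by
  obtain ⟨a, b, hab, hfj⟩ := exists_pair hf
  obtain ⟨a', b', hab', hqj⟩ := exists_pair hq
  have third {n : ℕ} (hn : 3 ≤ n) (a b : Fin n) : ∃ c, a ≠ c ∧ b ≠ c := by
    by_contra! h
    have h2 := Finset.card_le_two (a := a) (b := b)
    have huniv : ({a, b} : Finset (Fin n)) = Finset.univ := by
      refine Finset.eq_univ_iff_forall.2 fun c => ?_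
      by_cases hc : a = c
      · simp [hc]
      · simp [h c hc]
    rw [huniv, Finset.card_univ, Fintype.card_fin] at h2
    omega
  obtain ⟨c, hac, hbc⟩ := third (by omega) a b
  obtain ⟨c', hac', hbc'⟩ := third (by omega) a' b'
  obtain ⟨p, hp, rfl, rfl, -⟩ := exists_injective_extension hk hab' hac' hbc' hab hac hbc
  exact ⟨p, hp, eq_of_pair hp hqj hfj⟩

variable {E : Type*} [DecidableEq E]

/-- Two cycle double covers of the edges at a vertex of degree at most three have the same
pattern. -/
theorem exists_matching {k : ℕ} (hk : 4 ≤ k) {N L : Finset E} (hNL : N.card + 2 * L.card ≤ 3)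
    {f : Fin k → E → ZMod 2} {q : Fin 4 → E → ZMod 2}
    (hfN : ∀ j, ∑ e ∈ N, f j e = 0) (hqN : ∀ i, ∑ e ∈ N, q i e = 0)
    (hf : ∀ e ∈ N ∪ L, (Finset.univ.filter fun j => f j e = 1).card = 2)
    (hq : ∀ e ∈ N ∪ L, (Finset.univ.filter fun i => q i e = 1).card = 2) :
    ∃ p : Fin 4 → Fin k, Function.Injective p ∧ ∀ e ∈ N ∪ L, ∀ i, f (p i) e = q i e := by
  -- A single non-loop edge would lie in no cycle at all. Hence a loop excludes other edges here, as
  -- `N` and `L` count degree at most 3.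
  have hN1 : N.card ≠ 1 := by
    intro h
    obtain ⟨e, rfl⟩ := Finset.card_eq_one.1 h
    have h2 := hf e (by simp)
    simp only [Finset.sum_singleton] at hfN
    simp [hfN] at h2
  have eq_add : ∀ x y : ZMod 2, x + y = 0 → y = x := by decide
  by_cases hL : L.card = 0
  · rw [Finset.card_eq_zero] at hL
    subst hL
    simp only [Finset.union_empty] at *
    obtain h | h | h : N.card = 0 ∨ N.card = 2 ∨ N.card = 3 := by
      rw [Finset.card_empty] at hNL
      omega
    · rw [Finset.card_eq_zero] at h
      subst h
      exact ⟨Fin.castLE hk, Fin.castLE_injective hk, by simp⟩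
    · obtain ⟨e, e', hee, rfl⟩ := Finset.card_eq_two.1 h
      simp only [Finset.sum_pair hee] at hfN hqN
      obtain ⟨p, hp, hpe⟩ := exists_matching_pair hk (hf e (by simp)) (hq e (by simp))
      refine ⟨p, hp, fun d hd i => ?_⟩
      rcases Finset.mem_insert.1 hd with rfl | hd
      · exact hpe i
      · rw [Finset.mem_singleton.1 hd, eq_add _ _ (hfN _), eq_add _ _ (hqN _), hpe]
    · obtain ⟨e₁, e₂, e₃, h12, h13, h23, rfl⟩ := Finset.card_eq_three.1 h
      have sum3 {F : E → ZMod 2} (hF : ∑ e ∈ {e₁, e₂, e₃}, F e = 0) : F e₃ = F e₁ + F e₂ := by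
        rw [Finset.sum_insert (by simp [h12, h13]), Finset.sum_pair h23, ← add_assoc] at hF
        exact eq_add _ _ hF
      have hf3 : ∀ j, f j e₃ = f j e₁ + f j e₂ := fun j => sum3 (hfN j)
      have hq3 : ∀ j, q j e₃ = q j e₁ + q j e₂ := fun j => sum3 (hqN j)
      obtain ⟨a, b, c, hab, hac, hbc, hf1, hf2⟩ := exists_triple (hf e₁ (by simp))
        (hf e₂ (by simp)) (by simpa only [hf3] using hf e₃ (by simp))
      obtain ⟨a', b', c', hab', hac', hbc', hq1, hq2⟩ := exists_triple (hq e₁ (by simp))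
        (hq e₂ (by simp)) (by simpa only [hq3] using hq e₃ (by simp))
      obtain ⟨p, hp, rfl, rfl, rfl⟩ := exists_injective_extension hk hab' hac' hbc' hab hac hbc
      have m1 := eq_of_pair hp hq1 hf1
      have m2 := eq_of_pair hp hq2 hf2
      refine ⟨p, hp, fun d hd i => ?_⟩
      simp only [Finset.mem_insert, Finset.mem_singleton] at hd
      rcases hd with rfl | rfl | rfl
      · exact m1 i
      · exact m2 i
      · rw [hf3, hq3, m1, m2]
  · have hN0 : N = ∅ := Finset.card_eq_zero.1 (by omega)
    obtain ⟨l, rfl⟩ := Finset.card_eq_one.1 (show L.card = 1 by omega)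
    subst hN0
    obtain ⟨p, hp, hpe⟩ := exists_matching_pair hk (hf l (by simp)) (hq l (by simp))
    refine ⟨p, hp, fun d hd i => ?_⟩
    obtain rfl : d = l := by simpa using hd
    exact hpe i

theorem exists_nowhere_zero_sum_eq_zero {N : Finset E} (hN : N.card ≤ 3) (hN1 : N.card ≠ 1) :
    ∃ f : E → ZMod 2 × ZMod 2, (∀ e, f e ≠ 0) ∧ ∑ e ∈ N, f e = 0 := by
  have one_ne : ((1, 1) : ZMod 2 × ZMod 2) ≠ 0 := by decide
  obtain h | h | h : N.card = 0 ∨ N.card = 2 ∨ N.card = 3 := by omega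
  · rw [Finset.card_eq_zero] at h
    subst h
    exact ⟨fun _ => (1, 1), fun _ => one_ne, by simp⟩
  · refine ⟨fun _ => (1, 1), fun _ => one_ne, ?_⟩
    rw [Finset.sum_const, h]
    decide
  · obtain ⟨e₁, e₂, e₃, h12, h13, h23, rfl⟩ := Finset.card_eq_three.1 h
    refine ⟨fun e => if e = e₁ then (0, 1) else if e = e₂ then (1, 0) else (1, 1), fun e => ?_, ?_⟩
    · dsimp only
      split_ifs <;> decide
    · rw [Finset.sum_insert (by simp [h12, h13]), Finset.sum_pair h23]
      simp [h12.symm, h13.symm, h23.symm]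
      decide

end Pattern

variable {V E M : Type*} [Fintype E] [AddCommGroup M] [Module (ZMod 2) M] {s t : E → V}

open scoped Classical in
theorem bd_eq_sum_nonloops (f : E → M) (x : V) :
    bd s t f x = ∑ e ∈ Finset.univ.filter fun e => ¬ (s e = x ↔ t e = x), f e := by
  rw [Finset.sum_filter]
  refine Finset.sum_congr rfl fun e _ => ?_
  by_cases hs : s e = x <;> by_cases ht : t e = x <;> simp [inc, hs, ht, add_self]

theorem bd_congr {f g : E → M} {x : V} (h : ∀ e, s e = x ∨ t e = x → f e = g e) :
    bd s t f x = bd s t g x := by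
  refine Finset.sum_congr rfl fun e _ => ?_
  by_cases hst : s e = x ∨ t e = x
  · rw [h e hst]
  · push Not at hst
    simp [inc, hst]

end EdgeSpace

namespace Graph

/-! ### Pulling a CDC back along an isomorphism -/

/-! ### Transport along isomorphisms -/

section Isom

variable {α β γ δ : Type*} {G : Graph α β} {H : Graph γ δ}

/-- The edges of `G` that correspond to edges in `F`. -/
def Isom.pullEdges (φ : G.Isom H) (F : Set δ) : Set β :=
  {d | ∃ h : d ∈ E(G), (φ.onEdges ⟨d, h⟩ : δ) ∈ F}

theorem Isom.isLink_pull (φ : G.Isom H) {C : Graph γ δ} (hC : C ≤ H) (e : E(G)) (x y : V(G)) :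
    (G.restrict (φ.pullEdges E(C))).IsLink e x y ↔
      C.IsLink (φ.onEdges e) (φ.onVertices x) (φ.onVertices y) := by
  rw [restrict_isLink, φ.isLink_iff]
  constructor
  · rintro ⟨⟨_, he⟩, hl⟩
    exact (hC.isLink_iff he).2 hl
  · intro hl
    exact ⟨⟨e.2, hl.edge_mem⟩, hl.mono hC⟩

theorem Isom.deg_pull (φ : G.Isom H) {C : Graph γ δ} (hC : C ≤ H) (v : V(G)) :
    (G.restrict (φ.pullEdges E(C))).deg v = C.deg (φ.onVertices v) := by
  have hmem : ∀ {d a}, (G.restrict (φ.pullEdges E(C))).Inc d a → d ∈ E(G) :=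
    fun h => (h.mono restrict_le).edge_mem
  have key : ∀ (A : Set β) (B : Set δ), A ⊆ E(G) → B ⊆ E(H) →
      (∀ e : E(G), (e : β) ∈ A ↔ (φ.onEdges e : δ) ∈ B) → A.ncard = B.ncard := by
    intro A B hA hB h
    refine Set.ncard_congr (fun d hd => (φ.onEdges ⟨d, hA hd⟩ : δ)) (fun d hd => (h _).1 hd) ?_ ?_
    · intro a b ha hb hab
      simpa using φ.onEdges.injective (Subtype.ext hab)
    · intro b hb
      refine ⟨φ.onEdges.symm ⟨b, hB hb⟩, (h _).2 ?_, ?_⟩ <;> simp [hb]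
  unfold deg
  congr 1
  · refine key _ _ (fun d hd => hmem hd.inc) (fun d hd => hC.edgeSet_mono hd.edge_mem) fun e => ?_
    constructor
    · rintro ⟨y, hy, hl⟩
      lift y to V(G) using hl.right_mem
      refine ⟨φ.onVertices y, fun h => hy ?_, (φ.isLink_pull hC e v y).1 hl⟩
      rw [φ.onVertices.injective (Subtype.ext h)]
    · rintro ⟨y, hy, hl⟩
      obtain ⟨y', hy'⟩ := φ.onVertices.surjective ⟨y, (hl.mono hC).right_mem⟩
      have hyy : (φ.onVertices y' : γ) = y := by rw [hy']
      subst hyy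
      refine ⟨y', fun h => hy ?_, (φ.isLink_pull hC e v y').2 hl⟩
      rw [Subtype.ext h]
  · congr 1
    exact key _ _ (fun d hd => hmem (IsLoopAt.inc hd))
      (fun d hd => hC.edgeSet_mono (IsLoopAt.edge_mem hd)) fun e => φ.isLink_pull hC e v v

theorem Isom.deg_eq (φ : G.Isom H) (v : V(G)) : G.deg v = H.deg (φ.onVertices v) := by
  rw [← φ.deg_pull le_rfl, (restrict_eq_self_iff G (φ.pullEdges E(H))).2 fun d hd =>
    ⟨hd, (φ.onEdges ⟨d, hd⟩).2⟩]

theorem Isom.exists_isCDC (φ : G.Isom H) {k : ℕ} {S : Fin k → Graph γ δ} (hS : H.IsCDC S) :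
    ∃ S' : Fin k → Graph α β, G.IsCDC S' := by
  refine ⟨fun i => G.restrict (φ.pullEdges E(S i)), fun i => ⟨restrict_le, fun v hv => ?_⟩,
    fun e he => ?_⟩
  · obtain ⟨v, rfl⟩ : ∃ v' : V(G), (v' : α) = v := ⟨⟨v, hv⟩, rfl⟩
    rw [φ.deg_pull (hS.1 i).1]
    by_cases hv' : (φ.onVertices v : γ) ∈ V(S i)
    · exact (hS.1 i).2 _ hv'
    · rw [deg_eq_zero hv']
      exact Even.zero
  · rw [← hS.2 _ (φ.onEdges ⟨e, he⟩).2]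
    congr 1
    ext i
    simp [pullEdges, he]

end Isom

/-! ### Assembling the cycles of `G` -/

section Main

variable {α β V E : Type*} [Fintype V] [Fintype E] {G C G' : Graph α β} {s t : E → V}
  {ι : E → β} {X : Set E} {π π₀ : V → α}

open scoped Classical in
theorem ncard_setOf_mem {k : ℕ} (S : Fin k → Graph α β) (d : β) :
    {i | d ∈ E(S i)}.ncard =
      (Finset.univ.filter fun i => (if d ∈ E(S i) then (1 : ZMod 2) else 0) = 1).card := by
  rw [← Set.ncard_coe_finset]
  congr 1
  ext i
  by_cases h : d ∈ E(S i) <;> simp [h]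

open scoped Classical in
/-- A cycle `C` and cycles that cover `C` once and all other edges twice form a cycle double
cover. -/
theorem Represents.exists_isCDC (h : Represents G s t ι ∅ π₀) (hCG : C ≤ G) (hC : C.IsEvenCycle)
    {n : ℕ} {F : Fin n → E → ZMod 2} (hF : ∀ j x, bd s t (F j) x = 0)
    (hcount : ∀ e, (Finset.univ.filter fun j => F j e = 1).card =
      if e ∈ ι ⁻¹' E(C) then 1 else 2) :
    ∃ S : Fin (n + 1) → Graph α β, G.IsCDC S ∧ ∃ i, S i = C := by
  have hind : ∀ j e, ι e ∈ E(G.restrict {d | ∃ e, ι e = d ∧ F j e = 1}) ↔ F j e = 1 := by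
    intro j e
    simp only [edgeSet_restrict, Set.mem_inter_iff, Set.mem_ofPred_eq]
    constructor
    · rintro ⟨-, e', he, hF'⟩
      rwa [← h.enc.inj he]
    · exact fun hF' => ⟨(h.enc.mem_iff _).2 ⟨e, by simp, rfl⟩, e, rfl, hF'⟩
  refine ⟨Fin.cons C fun j => G.restrict {d | ∃ e, ι e = d ∧ F j e = 1}, ⟨fun i => ?_, fun d hd => ?_⟩,
    0, rfl⟩
  · refine Fin.cases ⟨hCG, hC⟩ (fun j => ⟨restrict_le, ?_⟩) i
    rw [Fin.cons_succ, h.enc.isEvenCycle_iff restrict_le]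
    intro a
    rw [show (fun e => if ι e ∈ E(G.restrict {d | ∃ e, ι e = d ∧ F j e = 1}) then (1 : ZMod 2)
      else 0) = F j from funext fun e => ?_]
    · exact bd_comp_eq_zero π₀ (hF j) a
    · rw [if_congr (hind j e) rfl rfl]
      rcases zmod_two_eq_zero_or_one (F j e) with h0 | h0 <;> simp [h0]
  · obtain ⟨e, -, rfl⟩ := (h.enc.mem_iff d).1 hd
    have hset : {i | ι e ∈ E((Fin.cons C fun j => G.restrict {d | ∃ e, ι e = d ∧ F j e = 1} :
        Fin (n + 1) → Graph α β) i)} = (Finset.univ.filter fun i : Fin (n + 1) =>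
          (Fin.cons (ι e ∈ E(C)) fun j => F j e = 1 : Fin (n + 1) → Prop) i : Finset _) := by
      ext i
      simp only [Set.mem_ofPred_eq, Finset.coe_filter, Finset.mem_univ, true_and]
      refine Fin.cases ?_ (fun j => ?_) i
      · simp
      · simp only [Fin.cons_succ]
        exact hind j e
    rw [hset, Set.ncard_coe_finset, Finset.card_filter, Fin.sum_univ_succ]
    simp only [Fin.cons_zero, Fin.cons_succ]
    rw [← Finset.card_filter, hcount]
    by_cases he : ι e ∈ E(C) <;> simp [he]

-- The covering counts hold on every edge; merging costs only the conservation at vertices outside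
-- `W`.
open scoped Classical in
theorem exists_local_four_cycles {C' : Set E} {W : Set V}
    (hconn : ∀ x y, Joined s t C'ᶜ x y)
    (hC : ∀ x, bd s t (fun e => if e ∈ C' then (1 : ZMod 2) else 0) x = 0)
    (hflow : HasFlow s t C' W) :
    ∃ Q : Fin 4 → E → ZMod 2, (∀ i, ∀ x ∈ W, bd s t (Q i) x = 0) ∧
      ∀ e, (Finset.univ.filter fun i => Q i e = 1).card = if e ∈ C' then 1 else 2 := by
  obtain ⟨g, hg, hgC⟩ := hflow
  obtain ⟨Q, hQ, hcount⟩ := exists_four_cycles (s := merge W ∘ s) (t := merge W ∘ t) (C := C')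
    (fun e => (hconn _ _).comp (merge W)) (bd_comp_eq_zero _ hC) hg hgC
  exact ⟨Q, fun i x hx => by rw [← bd_merge_some (W := W) _ hx, hQ], hcount⟩

/-- A weighting of the contraction of `X` that is nowhere zero and conserved at `A` yields a flow
of the graph in which the vertices outside `A` are identified. -/
theorem Represents.hasFlow (h : Represents G' s t ι X π) (A : Set α)
    {f : E → ZMod 2 × ZMod 2} (hfX : ∀ e ∉ X, f e ≠ 0)
    (hf : ∀ a ∈ A, bd (π ∘ s) (π ∘ t) f a = 0) : HasFlow s t X (π ⁻¹' A) := by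
  obtain ⟨f', hf', hbd⟩ := exists_extension (s := s) (t := t) (fun x y => (h.eq_iff x y).1) A f hf
  exact ⟨f', hbd, fun e he => hf' e he ▸ hfX e he⟩

omit [Fintype V] in
open scoped Classical in
theorem Represents.bd_indicator (h : Represents G' s t ι X π) {k : ℕ} {S : Fin k → Graph α β}
    (hS : G'.IsCDC S) (j : Fin k) (a : α) :
    bd (π ∘ s) (π ∘ t) (fun e => if ι e ∈ E(S j) then (1 : ZMod 2) else 0) a = 0 :=
  (h.enc.isEvenCycle_iff (hS.1 j).1).1 (hS.1 j).2 a

omit [Fintype V] in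
open scoped Classical in
theorem Represents.card_indicator (h : Represents G' s t ι X π) {k : ℕ} {S : Fin k → Graph α β}
    (hS : G'.IsCDC S) {e : E} (he : e ∉ X) :
    (Finset.univ.filter fun j => (if ι e ∈ E(S j) then (1 : ZMod 2) else 0) = 1).card = 2 := by
  rw [← ncard_setOf_mem, hS.2 _ ((h.enc.mem_iff _).2 ⟨e, he, rfl⟩)]

open scoped Classical in
theorem Represents.exists_cycles_of_le_four (h : Represents G' s t ι X π) {C' : Set E}
    (hconn : ∀ x y, Joined s t C'ᶜ x y)
    (hC : ∀ x, bd s t (fun e => if e ∈ C' then (1 : ZMod 2) else 0) x = 0)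
    (hflow : ∀ A : Set α, HasFlow s t X (π ⁻¹' A) → HasFlow s t C' (π ⁻¹' A))
    {k : ℕ} (hk : k ≤ 4) {S : Fin k → Graph α β} (hS : G'.IsCDC S) :
    ∃ F : Fin 4 → E → ZMod 2, (∀ j x, bd s t (F j) x = 0) ∧
      ∀ e, (Finset.univ.filter fun j => F j e = 1).card = if e ∈ C' then 1 else 2 := by
  let σ : Fin 4 → E → ZMod 2 := fun i e =>
    fibreSum (Fin.castLE hk) (fun j => if ι e ∈ E(S j) then 1 else 0) i
  have hσ : ∀ i a, bd (π ∘ s) (π ∘ t) (σ i) a = 0 := fun i a => by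
    refine (bd_sum (π ∘ s) (π ∘ t) _
      (fun j e => if ι e ∈ E(S j) then (1 : ZMod 2) else 0) a).trans ?_
    exact Finset.sum_eq_zero fun j _ => h.bd_indicator hS j a
  have hσ2 : ∀ e ∉ X, (Finset.univ.filter fun i => σ i e = 1).card = 2 := fun e he =>
    (card_ones_fibreSum (Fin.castLE_injective hk) _).trans (h.card_indicator hS he)
  -- Label the four cycles by the four group elements, the last one by 0. An edge receives the sum
  -- of two distinct labels, which is nonzero.
  have hne : ∀ q : Fin 4 → ZMod 2, (Finset.univ.filter fun i => q i = 1).card = 2 →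
      q 0 • ((1, 1) : ZMod 2 × ZMod 2) + (q 1 • (1, 0) + q 2 • (0, 1)) ≠ 0 := by decide
  obtain ⟨Q, hQ, hcount⟩ := exists_local_four_cycles hconn hC (hflow Set.univ
    (h.hasFlow Set.univ (f := fun e => σ 0 e • (1, 1) + (σ 1 e • (1, 0) + σ 2 e • (0, 1)))
      (fun e he => hne (fun i => σ i e) (hσ2 e he)) fun a _ => by
        simp only [bd_add, bd_smul_const, hσ, zero_smul, add_zero]))
  exact ⟨Q, fun i x => hQ i x trivial, hcount⟩

open scoped Classical in
theorem Represents.exists_cycles_of_deg_le_three (h : Represents G' s t ι X π) {C' : Set E}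
    (hCX : C' ⊆ X) (hconn : ∀ x y, Joined s t C'ᶜ x y)
    (hC : ∀ x, bd s t (fun e => if e ∈ C' then (1 : ZMod 2) else 0) x = 0)
    (hflow : ∀ A : Set α, HasFlow s t X (π ⁻¹' A) → HasFlow s t C' (π ⁻¹' A))
    (hdeg : ∀ a ∈ V(G'), G'.deg a ≤ 3)
    {k : ℕ} (hk : 4 ≤ k) {S : Fin k → Graph α β} (hS : G'.IsCDC S) :
    ∃ F : Fin k → E → ZMod 2, (∀ j x, bd s t (F j) x = 0) ∧
      ∀ e, (Finset.univ.filter fun j => F j e = 1).card = if e ∈ C' then 1 else 2 := by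
  let σ : Fin k → E → ZMod 2 := fun j e => if ι e ∈ E(S j) then 1 else 0
  have hσ2 : ∀ e ∉ X, (Finset.univ.filter fun j => σ j e = 1).card = 2 := fun e he =>
    h.card_indicator hS he
  have hpi : ∀ e ∈ X, π (s e) = π (t e) := fun e he => (h.eq_iff _ _).2 (.of_mem he)
  -- For each `a`, four weightings conserved on its fibre, placed by `p` so as to agree with the CDC
  -- on the edges of `G'` at `a`.
  have hlocal : ∀ a : α, ∃ (Q : Fin 4 → E → ZMod 2) (p : Fin 4 → Fin k),
      (∀ i x, π x = a → bd s t (Q i) x = 0) ∧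
      (∀ e, (Finset.univ.filter fun i => Q i e = 1).card = if e ∈ C' then 1 else 2) ∧
      Function.Injective p ∧
      ∀ e ∉ X, (π (s e) = a ∨ π (t e) = a) → ∀ i, σ (p i) e = Q i e := by
    intro a
    obtain ⟨N, hN⟩ : ∃ N : Finset E,
        N = Finset.univ.filter fun e => ¬ (π (s e) = a ↔ π (t e) = a) := ⟨_, rfl⟩
    obtain ⟨L, hL⟩ : ∃ L : Finset E,
        L = Finset.univ.filter fun e => e ∉ X ∧ π (s e) = a ∧ π (t e) = a := ⟨_, rfl⟩
    have hG' : ∀ e, ι e ∈ E(G') ↔ e ∉ X := fun e =>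
      ⟨h.enc.mem, fun he => (h.enc.mem_iff _).2 ⟨e, he, rfl⟩⟩
    have hNX : ∀ e ∈ N, e ∉ X := fun e he heX => by
      rw [hN, Finset.mem_filter, hpi e heX] at he
      exact he.2 Iff.rfl
    have hNL : N.card + 2 * L.card ≤ 3 := by
      have hd : G'.deg a ≤ 3 := by
        by_cases ha : a ∈ V(G')
        · exact hdeg a ha
        · rw [deg_eq_zero ha]
          omega
      rw [h.enc.deg_eq le_rfl] at hd
      convert hd using 3
      · rw [hN]
        ext e
        simp only [Finset.mem_filter, Finset.mem_univ, true_and, hG', Function.comp]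
        refine ⟨fun h' => ⟨hNX e ?_, h'⟩, fun h' => h'.2⟩
        rw [hN, Finset.mem_filter]
        exact ⟨Finset.mem_univ _, h'⟩
      · simp only [hL, hG', Function.comp]
    have hσN : ∀ j, ∑ e ∈ N, σ j e = 0 := fun j => by
      have := h.bd_indicator hS j a
      rw [bd_eq_sum_nonloops] at this
      rw [hN]
      exact this
    have hN1 : N.card ≠ 1 := fun h1 => by
      obtain ⟨e, he⟩ := Finset.card_eq_one.1 h1
      have h2 := hσ2 e (hNX e (by simp [he]))
      simp only [he, Finset.sum_singleton] at hσN
      simp [hσN] at h2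
    obtain ⟨f, hf0, hfN⟩ := exists_nowhere_zero_sum_eq_zero (N := N) (by omega) hN1
    obtain ⟨Q, hQ, hcount⟩ := exists_local_four_cycles hconn hC (hflow {a}
      (h.hasFlow {a} (f := f) (fun e _ => hf0 e) (by
        rintro _ rfl
        rw [bd_eq_sum_nonloops, ← hfN, hN]
        rfl)))
    -- Conservation summed over the fibre of `a` becomes conservation at `a` in the contraction.
    have hQN : ∀ i, ∑ e ∈ N, Q i e = 0 := fun i => by
      have := bd_comp (s := s) (t := t) π (Q i) a
      rw [Finset.sum_eq_zero, bd_eq_sum_nonloops] at this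
      · rw [hN]
        exact this
      · intro x _
        by_cases hx : π x = a
        · rw [hQ i x hx, smul_zero]
        · rw [if_neg hx, zero_smul]
    have hNLX : ∀ e ∈ N ∪ L, e ∉ X := fun e he => by
      rcases Finset.mem_union.1 he with he | he
      · exact hNX e he
      · rw [hL, Finset.mem_filter] at he
        exact he.2.1
    obtain ⟨p, hp, hmatch⟩ := exists_matching hk hNL hσN hQN (fun e he => hσ2 e (hNLX e he))
      (fun e he => by rw [hcount, if_neg fun h' => hNLX e he (hCX h')])
    refine ⟨Q, p, fun i x hx => hQ i x hx, hcount, hp, fun e heX hea => hmatch e ?_⟩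
    rw [Finset.mem_union, hN, hL, Finset.mem_filter, Finset.mem_filter]
    simp only [Finset.mem_univ, true_and]
    tauto
  choose Q p hQ hcount hp hmatch using hlocal
  have hfib : ∀ a e, e ∉ X → (π (s e) = a ∨ π (t e) = a) →
      (fun j => σ j e) = fibreSum (p a) fun i => Q a i e := fun a e he hea =>
    eq_fibreSum (hp a) (hmatch a e he hea) (by
      rw [hσ2 e he, hcount, if_neg fun h' => he (hCX h')])
  -- Both ends of an edge of `X` lie in one fibre, so `s e` selects its local solution
  -- unambiguously. At any vertex `x` the glued weighting coincides with the local one for `π x`,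
  -- hence is conserved.
  refine ⟨fun j e => if e ∈ X then fibreSum (p (π (s e))) (fun i => Q (π (s e)) i e) j else σ j e,
    fun j x => ?_, fun e => ?_⟩
  · rw [bd_congr (g := fun e => fibreSum (p (π x)) (fun i => Q (π x) i e) j)]
    · refine (bd_sum s t _ (Q (π x)) x).trans ?_
      exact Finset.sum_eq_zero fun i _ => hQ _ i x rfl
    · intro e hex
      have hex' : π (s e) = π x ∨ π (t e) = π x := by
        rcases hex with rfl | rfl
        · exact .inl rfl
        · exact .inr rfl
      dsimp only
      by_cases he : e ∈ X
      · have hse : π (s e) = π x := by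
          rcases hex' with hex' | hex'
          · exact hex'
          · rw [hpi e he, hex']
        rw [if_pos he, hse]
      · rw [if_neg he]
        exact congrFun (hfib (π x) e he hex') j
  · by_cases he : e ∈ X
    · simp only [if_pos he]
      rw [card_ones_fibreSum (hp _), hcount]
    · simp only [if_neg he]
      rw [hσ2 e he, if_neg fun h' => he (hCX h')]

end Main
end Graph

theorem lemma3p5 {α β γ δ : Type*} (G C : Graph α β) (H : Graph γ δ) (k : ℕ)
    (hV : G.vertexSet.Finite) (hE : G.edgeSet.Finite)
    (hC : C.IsEvenCycle) (hCG : G.IsNonseparating C)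
    (hG : Graph.IsGirthDegenerate 4 H (G.contract C.edgeSet))
    (hH : ∀ v ∈ H.vertexSet, H.deg v ≤ 3)
    (hHk : ∃ S : Fin k → Graph γ δ, H.IsCDC S) :
    (5 ≤ k → ∃ S : Fin (k + 1) → Graph α β, G.IsCDC S ∧ ∃ i, S i = C) ∧
    (k ≤ 4 → ∃ S : Fin 5 → Graph α β, G.IsCDC S ∧ ∃ i, S i = C) := by
  classical
  obtain ⟨G', hGG', ⟨φ⟩⟩ := hG
  obtain ⟨S, hS⟩ := hHk
  obtain ⟨S, hS⟩ := φ.exists_isCDC hS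
  have hdeg : ∀ a ∈ G'.vertexSet, G'.deg a ≤ 3 := fun a ha =>
    (φ.deg_eq ⟨a, ha⟩).trans_le (hH _ (φ.onVertices ⟨a, ha⟩).2)
  have : Fintype G.vertexSet := hV.fintype
  have : Fintype G.edgeSet := hE.fintype
  have hends : ∀ e : G.edgeSet, ∃ x y : G.vertexSet, G.IsLink e x y := fun e => by
    obtain ⟨x, y, hxy⟩ := Graph.exists_isLink_of_mem_edgeSet e.2
    exact ⟨⟨x, hxy.left_mem⟩, ⟨y, hxy.right_mem⟩, hxy⟩
  choose s t hst using hends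
  have hrep : G.Represents s t Subtype.val ∅ Subtype.val := by
    refine ⟨⟨Subtype.val_injective, fun d => ?_, fun e _ => hst e⟩, Subtype.range_val,
      fun x y => ?_⟩
    · simp
    · rw [EdgeSpace.joined_empty_iff, Subtype.val_inj]
  -- Non-separation of `C` in the language of joins.
  have hconn : ∀ x y, EdgeSpace.Joined s t (Subtype.val ⁻¹' C.edgeSet)ᶜ x y := fun x y => by
    refine (hrep.joined_of_reachable Graph.deleteEdges_le (hCG.2.2 x x.2 y y.2) rfl _ rfl).mono ?_
    rintro e (he | he)
    · exact absurd he (by simp)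
    · exact he.2
  have hCbd : ∀ x, EdgeSpace.bd s t
      (fun e => if e ∈ Subtype.val ⁻¹' C.edgeSet then (1 : ZMod 2) else 0) x = 0 := fun x => by
    have h := (hrep.enc.isEvenCycle_iff hCG.1).1 hC x
    rw [EdgeSpace.bd_comp, Finset.sum_eq_single x] at h
    · simpa using h
    · intro y _ hy
      rw [if_neg fun h' => hy (Subtype.ext h'), zero_smul]
    · simp
  obtain ⟨X, π, hCX, hrep', hflow⟩ :=
    (hrep.contract C.edgeSet).exists_of_contractsCircuit hGG'
  rw [Set.empty_union] at hCX hflow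
  constructor
  · intro hk
    obtain ⟨F, hF, hcount⟩ :=
      hrep'.exists_cycles_of_deg_le_three hCX hconn hCbd hflow hdeg (by omega) hS
    exact hrep.exists_isCDC hCG.1 hC hF hcount
  · intro hk
    obtain ⟨F, hF, hcount⟩ := hrep'.exists_cycles_of_le_four hconn hCbd hflow hk hS
    exact hrep.exists_isCDC hCG.1 hC hF hcount
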